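/- Let $\mathbb{K}$ be a field of characteristic zero, $S=\mathbb{K}[x,y]$, and let $z_3\in\mathbb{K}\setminus\{0\}$ be algebraic over $\mathbb{Q}$ and $z_4\in\mathbb{K}$ transcendental over $\mathbb{Q}$. Let $\mathcal{A}$ be the arrangement in $\mathbb{K}^2$ consisting of the four distinct lines that are the kernels of $\alpha_1=x$, $\alpha_2=y$, $\alpha_3=x-z_3y$, $\alpha_4=x-z_4y$, and let $m$ be a multiplicity on $\mathcal{A}$ giving the positive integer $m_i$ to $\ker\alpha_i$, so that $(\mathcal{A},m)$ is the multiarrangement defined by $$x^{m_1}y^{m_2}(x-z_3y)^{m_3}(x-z_4y)^{m_4}.$$ Put $|m|=m_1+m_2+m_3+m_4$ and assume that $m$ is balanced, that is, $m_i<|m|/2$ for all $i$. Let $$D(\mathcal{A},m)=\{\theta\in\operatorname{Der}_{\mathbb{K}}S \mid \theta(\alpha_i)\in\alpha_i^{m_i}S \text{ for } i=1,2,3,4\}.$$ If $m$ is not identically $1$, then $D(\mathcal{A},m)$ is a free $S$-module with a basis of two homogeneous derivations (a derivation $f\partial_x+g\partial_y$ is homogeneous of degree $d$ if $f$ and $g$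 are homogeneous polynomials of degree $d$), and for every such basis the degrees $d_1,d_2$ satisfy $$\Delta(\mathcal{A},m):=|d_1-d_2|\le 1.$$ In particular $\Delta(\mathcal{A},m)\ne|\mathcal{A}|-2$: the arrangement $\mathcal{A}$ admits no balanced multiplicity other than $m\equiv 1$ that attains Abe's bound $\Delta(\mathcal{A},m)\le|\mathcal{A}|-2$. -/

import Mathlib

/-- An `ℓ`-dimensional multiarrangement over `K`: a finite non-empty set of linear hyperplanes of
`K^ℓ`, each with a positive integer multiplicity. -/
structure Multiarrangement (K : Type*) [Field K] (ℓ : ℕ) where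
  hyperplanes : Finset (Submodule K (Fin ℓ → K))
  nonempty : hyperplanes.Nonempty
  codim_one : ∀ H ∈ hyperplanes, Module.finrank K ((Fin ℓ → K) ⧸ H) = 1
  mult : hyperplanes → ℕ
  mult_pos : ∀ H, 0 < mult H

namespace Multiarrangement

variable {K : Type*} [Field K] {ℓ : ℕ}

/-- A linear form on `K^ℓ` as a linear polynomial in the coordinates. -/
noncomputable def formPoly (α : Module.Dual K (Fin ℓ → K)) : MvPolynomial (Fin ℓ) K :=
  ∑ i, MvPolynomial.C (α (Pi.single i 1)) * MvPolynomial.X i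

/-- The multiarrangement is the one with defining polynomial `∏ i, (α i) ^ (k i)`: the kernels of
the linear forms `α i` are the hyperplanes, each listed exactly once, and the hyperplane `ker (α i)`
has multiplicity `k i`. -/
def IsDefinedBy (A : Multiarrangement K ℓ) {ι : Type*}
    (α : ι → Module.Dual K (Fin ℓ → K)) (k : ι → ℕ) : Prop :=
  ∃ e : ι ≃ A.hyperplanes, ∀ i, LinearMap.ker (α i) = (e i).1 ∧ A.mult (e i) = k i

/-- The size `|m|` of the multiplicity. -/
def size (A : Multiarrangement K ℓ) : ℕ := ∑ H, A.mult H

/-- Balanced: `m(H) < |m| / 2` for every hyperplane `H`. -/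
def IsBalanced (A : Multiarrangement K ℓ) : Prop := ∀ H, 2 * A.mult H < A.size

/-- Simple: the multiplicity is identically `1`. -/
def IsSimple (A : Multiarrangement K ℓ) : Prop := ∀ H, A.mult H = 1

/-- The logarithmic derivation module `D(A, m)`: all `θ` with `θ(α_H) ∈ α_H ^ m(H) S` for every `H`,
where `α_H` is a linear form with kernel `H` (the condition is the same for each such form). -/
noncomputable def logDer (A : Multiarrangement K ℓ) :
    Submodule (MvPolynomial (Fin ℓ) K)
      (Derivation K (MvPolynomial (Fin ℓ) K) (MvPolynomial (Fin ℓ) K)) where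
  carrier := {θ | ∀ (H : A.hyperplanes) (α : Module.Dual K (Fin ℓ → K)),
    LinearMap.ker α = H.1 → formPoly α ^ A.mult H ∣ θ (formPoly α)}
  zero_mem' := fun H α _ => by simp
  add_mem' := fun {θ η} hθ hη H α h => by
    simpa using dvd_add (hθ H α h) (hη H α h)
  smul_mem' := fun f θ hθ H α h => by
    simpa using Dvd.dvd.mul_left (hθ H α h) f

/-- `θ = ∑ f_i ∂_i` is homogeneous of degree `d`: every coefficient `f_i = θ(x_i)` is a homogeneous
polynomial of degree `d`. -/
def IsHomogeneousDer (θ : Derivation K (MvPolynomial (Fin ℓ) K) (MvPolynomial (Fin ℓ) K))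
    (d : ℕ) : Prop :=
  ∀ i, (θ (MvPolynomial.X i)).IsHomogeneous d

/-- The multiarrangement is free with exponents `(d_1, …, d_ℓ)`: its logarithmic derivation module
has a basis of homogeneous derivations of these degrees. -/
def HasExponents (A : Multiarrangement K ℓ) (d : Fin ℓ → ℕ) : Prop :=
  ∃ b : Module.Basis (Fin ℓ) (MvPolynomial (Fin ℓ) K) A.logDer,
    ∀ i, IsHomogeneousDer (b i).1 (d i)

/-- `Δ(A, m) = δ` for a `2`-multiarrangement: it is free, and `δ = |d_1 - d_2|` for exponents
`(d_1, d_2)`. -/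
def HasDifference (A : Multiarrangement K 2) (δ : ℤ) : Prop :=
  ∃ d : Fin 2 → ℕ, A.HasExponents d ∧ δ = |(d 0 : ℤ) - (d 1 : ℤ)|

end Multiarrangement

/-! The heart is a vanishing statement: no non-zero logarithmic derivation has degree d with 2d + 2
≤ |m| (`IsLogPair.eq_zero_of_transcendental`). Granting it, put k = ⌊|m|/2⌋. A dimension count gives
logarithmic derivations of degrees k and |m| - k with non-zero determinant, and by Saito's criterion
they form a basis. In any homogeneous basis both degrees are at least k and their sum is at most
|m|, so they differ by at most 1.

For the vanishing, set z = x/y and write a derivation as a pair (f, g) of polynomials in z;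
divisibility of θ(y) by y^b becomes the vanishing of the coefficients of g above d - b. Write a, b,
c, e for the multiplicities. Balance makes f and g linearly independent. Their Wronskian is
divisible by z^(a-1) (z-p)^(c-1) (z-q)^(e-1) and has degree below 2d - b, so |m| ≤ 2d + 2. Only |m|
= 2d + 2 remains, where the Wronskian equals that product up to a constant.

Symmetry lets a be the largest and e the smallest multiplicity, and scaling gives p = 1, q = t with
t transcendental. A linear functional moves the pair to F(t), and clearing denominators moves it to
F[t]. Let u, v, w be the primitive parts of f, g, f - g with respect to t. Any two of them that
remain independent at every value of t, including infinity, have t-degrees adding up to e - 1, the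
t-degree of (z-t)^(e-1) (`natDegree_swap_add_natDegree_swap`). On the other hand, letting the lines
x = 0 and x = ty collide at t = 0 forces a power of t into the constant term of v
(`exists_X_pow_dvd_coeff_zero`). That power exceeds the t-degree of v unless v(0) = 0; but then z^a
divides the Wronskian of u and v, whose order at z = 0 is exactly a - 1. -/

section

open Polynomial

/-! ### Wronskians of polynomials. -/

section Wronskian

variable {R : Type*} [CommRing R]

theorem wronskian_C_mul_left (a : R) (u v : R[X]) :
    wronskian (C a * u) v = C a * wronskian u v := by
  simp only [wronskian, derivative_C_mul]; ring

theorem wronskian_C_mul_right (a : R) (u v : R[X]) :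
    wronskian u (C a * v) = C a * wronskian u v := by
  simp only [wronskian, derivative_C_mul]; ring

theorem wronskian_sub_C_mul_left (a : R) (u v : R[X]) :
    wronskian (u - C a * v) v = wronskian u v := by
  simp only [wronskian, derivative_C_mul, derivative_sub]; ring

theorem wronskian_mul_mul (c u v : R[X]) :
    wronskian (c * u) (c * v) = c ^ 2 * wronskian u v := by
  simp only [wronskian, derivative_mul]; ring

theorem wronskian_map {S : Type*} [CommRing S] (φ : R →+* S) (u v : R[X]) :
    (wronskian u v).map φ = wronskian (u.map φ) (v.map φ) := by
  simp [wronskian, derivative_map]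

theorem pow_sub_one_dvd_wronskian {r u : R[X]} {m : ℕ} (h : r ^ m ∣ u) (v : R[X]) :
    r ^ (m - 1) ∣ wronskian u v := by
  have h1 : r ^ (m - 1) ∣ u := (pow_dvd_pow r (Nat.sub_le m 1)).trans h
  exact dvd_sub (h1.mul_right _) ((pow_sub_one_dvd_derivative_of_pow_dvd h).mul_right _)

open Classical in
-- Dividing by the gcd scales the Wronskian by a square. Coprime polynomials with zero Wronskian
-- have zero derivatives, hence are constants in characteristic zero.
theorem exists_eq_C_mul_of_wronskian_eq_zero {K : Type*} [Field K] [CharZero K] {f g : K[X]}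
    (hf : f ≠ 0) (h : wronskian f g = 0) : ∃ a : K, g = C a * f := by
  obtain ⟨f', hf'⟩ := EuclideanDomain.gcd_dvd_left f g
  obtain ⟨g', hg'⟩ := EuclideanDomain.gcd_dvd_right f g
  have hc : EuclideanDomain.gcd f g ≠ 0 := fun h0 => hf (by rw [hf', h0, zero_mul])
  have hcop : IsCoprime f' g' := by
    have := EuclideanDomain.gcd_eq_gcd_ab f g
    refine ⟨EuclideanDomain.gcdA f g, EuclideanDomain.gcdB f g, mul_left_cancel₀ hc ?_⟩
    calc _ = (EuclideanDomain.gcd f g * f') * EuclideanDomain.gcdA f g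
          + (EuclideanDomain.gcd f g * g') * EuclideanDomain.gcdB f g := by ring
      _ = _ := by rw [← hf', ← hg', ← this, mul_one]
  generalize EuclideanDomain.gcd f g = c at *
  subst hf' hg'
  rw [wronskian_mul_mul] at h
  have hw := (mul_eq_zero.1 h).resolve_left (pow_ne_zero _ hc)
  obtain ⟨h1, h2⟩ := hcop.wronskian_eq_zero_iff.1 hw
  have e1 := eq_C_of_natDegree_eq_zero (derivative_eq_zero.1 h1)
  have e2 := eq_C_of_natDegree_eq_zero (derivative_eq_zero.1 h2)
  have hne : f'.coeff 0 ≠ 0 := fun h0 => hf (by rw [e1, h0]; simp)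
  refine ⟨g'.coeff 0 / f'.coeff 0, ?_⟩
  rw [e1, e2]
  simp only [coeff_C_zero]
  rw [mul_left_comm, ← C_mul, div_mul_cancel₀ _ hne]

end Wronskian

/-! ### Logarithmic pairs, the Wronskian bound, and the symmetries of the four lines. -/

/-- The dehomogenization `(θ(x)(z, 1), θ(y)(z, 1))` of a homogeneous derivation `θ` of degree `d`
that is logarithmic along `x = 0`, `y = 0`, `x = p y` and `x = q y` with multiplicities
`a`, `b`, `c` and `e`. -/
structure IsLogPair {R : Type*} [CommRing R] (p q : R) (a b c e d : ℕ) (f g : R[X]) : Prop where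
  coeff_left : ∀ i, d < i → f.coeff i = 0
  coeff_right : ∀ i, d < i + b → g.coeff i = 0
  dvd_zero : X ^ a ∣ f
  dvd_fst : (X - C p) ^ c ∣ f - C p * g
  dvd_snd : (X - C q) ^ e ∣ f - C q * g

namespace IsLogPair

section Ring

variable {R : Type*} [CommRing R] {p q : R} {a b c e d : ℕ} {f g : R[X]}

theorem natDegree_left_le (h : IsLogPair p q a b c e d f g) : f.natDegree ≤ d :=
  natDegree_le_iff_coeff_eq_zero.2 h.coeff_left

theorem natDegree_right_add_le (h : IsLogPair p q a b c e d f g) (hg : g ≠ 0) :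
    g.natDegree + b ≤ d := by
  by_contra! h1
  exact hg (leadingCoeff_eq_zero.1 (h.coeff_right _ h1))

theorem natDegree_right_le (h : IsLogPair p q a b c e d f g) : g.natDegree ≤ d := by
  by_cases hg : g = 0
  · simp [hg]
  · have := h.natDegree_right_add_le hg; omega

theorem natDegree_sub_C_mul_le (h : IsLogPair p q a b c e d f g) (r : R) :
    (f - C r * g).natDegree ≤ d :=
  (natDegree_sub_le_of_le h.natDegree_left_le
    ((natDegree_C_mul_le r g).trans h.natDegree_right_le)).trans (max_self d).le

theorem swap_points (h : IsLogPair p q a b c e d f g) : IsLogPair q p a b e c d f g :=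
  ⟨h.coeff_left, h.coeff_right, h.dvd_zero, h.dvd_snd, h.dvd_fst⟩

theorem natDegree_wronskian_add_lt (h : IsLogPair p q a b c e d f g) (hw : wronskian f g ≠ 0) :
    (wronskian f g).natDegree + b < 2 * d := by
  have hg : g ≠ 0 := by rintro rfl; simp at hw
  have h1 := natDegree_wronskian_lt_add hw
  have h2 := h.natDegree_left_le
  have h3 := h.natDegree_right_add_le hg
  omega

theorem map {S : Type*} [CommRing S] (φ : R →+* S) (h : IsLogPair p q a b c e d f g) :
    IsLogPair (φ p) (φ q) a b c e d (f.map φ) (g.map φ) where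
  coeff_left i hi := by simp [h.coeff_left i hi]
  coeff_right i hi := by simp [h.coeff_right i hi]
  dvd_zero := by simpa using Polynomial.map_dvd φ h.dvd_zero
  dvd_fst := by simpa using Polynomial.map_dvd φ h.dvd_fst
  dvd_snd := by simpa using Polynomial.map_dvd φ h.dvd_snd

theorem dvd_zero_wronskian (h : IsLogPair p q a b c e d f g) : X ^ (a - 1) ∣ wronskian f g :=
  pow_sub_one_dvd_wronskian h.dvd_zero g

/-- Subtracting a constant multiple of `g` from `f` leaves the Wronskian unchanged, so `f` may be
replaced by `f - C p * g`. -/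
theorem dvd_fst_wronskian (h : IsLogPair p q a b c e d f g) :
    (X - C p) ^ (c - 1) ∣ wronskian f g := by
  rw [← wronskian_sub_C_mul_left p]
  exact pow_sub_one_dvd_wronskian h.dvd_fst g

theorem dvd_snd_wronskian (h : IsLogPair p q a b c e d f g) :
    (X - C q) ^ (e - 1) ∣ wronskian f g := h.swap_points.dvd_fst_wronskian

end Ring

section Field

variable {K : Type*} [Field K] {p q : K} {a b c e d : ℕ} {f g : K[X]}

theorem isCoprime_X_pow {p : K} (hp : p ≠ 0) (a c : ℕ) :
    IsCoprime (X ^ a : K[X]) ((X - C p) ^ c) := by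
  have := isCoprime_X_sub_C_of_isUnit_sub (R := K) (a := 0) (b := p) (by simpa using hp)
  simpa using this.pow (m := a) (n := c)

theorem isCoprime_sub_pow {p q : K} (hpq : p ≠ q) (a c : ℕ) :
    IsCoprime ((X - C p) ^ a : K[X]) ((X - C q) ^ c) :=
  (isCoprime_X_sub_C_of_isUnit_sub (by simpa [sub_eq_zero] using hpq)).pow

theorem add_add_le_natDegree_of_dvd {u : K[X]} (hu : u ≠ 0) (hp : p ≠ 0) (hq : q ≠ 0) (hpq : p ≠ q)
    (h1 : X ^ a ∣ u) (h2 : (X - C p) ^ c ∣ u) (h3 : (X - C q) ^ e ∣ u) :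
    a + c + e ≤ u.natDegree := by
  have h := ((isCoprime_X_pow hq a e).mul_left (isCoprime_sub_pow hpq c e)).mul_dvd
    ((isCoprime_X_pow hp a c).mul_dvd h1 h2) h3
  have := natDegree_le_of_dvd h hu
  rw [(((monic_X_pow a).mul ((monic_X_sub_C p).pow c))).natDegree_mul ((monic_X_sub_C q).pow e),
    (monic_X_pow a).natDegree_mul ((monic_X_sub_C p).pow c)] at this
  simpa using this

theorem add_le_natDegree_of_dvd {u : K[X]} (hu : u ≠ 0) (hp : p ≠ 0)
    (h1 : X ^ a ∣ u) (h2 : (X - C p) ^ c ∣ u) : a + c ≤ u.natDegree := by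
  have h := (isCoprime_X_pow hp a c).mul_dvd h1 h2
  have := natDegree_le_of_dvd h hu
  rw [(monic_X_pow a).natDegree_mul ((monic_X_sub_C p).pow c)] at this
  simpa using this

/-- A zero Wronskian would make the derivation a polynomial times a constant vector field. Such a
field is tangent to at most one of the lines, so the polynomial absorbs the multiplicities of the
other three, whose sum exceeds `d`. -/
theorem wronskian_ne_zero [CharZero K] (h : IsLogPair p q a b c e d f g) (hp : p ≠ 0) (hq : q ≠ 0)
    (hpq : p ≠ q) (hfg : f ≠ 0 ∨ g ≠ 0) (h1 : d < b + c + e) (h2 : d < a + c + e)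
    (h3 : d < a + b + e) (h4 : d < a + b + c) : wronskian f g ≠ 0 := by
  intro hw
  have hf : f ≠ 0 := by
    rintro rfl
    have hg : g ≠ 0 := by simpa using hfg
    have e1 : (X - C p) ^ c ∣ g := by
      have := h.dvd_fst
      rwa [zero_sub, dvd_neg, IsUnit.dvd_mul_left (by simpa using hp)] at this
    have e2 : (X - C q) ^ e ∣ g := by
      have := h.dvd_snd
      rwa [zero_sub, dvd_neg, IsUnit.dvd_mul_left (by simpa using hq)] at this
    have := add_add_le_natDegree_of_dvd (a := 0) hg hp hq hpq (by simp) e1 e2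
    have := h.natDegree_right_add_le hg
    omega
  obtain ⟨l, rfl⟩ := exists_eq_C_mul_of_wronskian_eq_zero hf hw
  have hdeg := h.natDegree_left_le
  have key : ∀ {r : K} {n : ℕ}, (X - C r) ^ n ∣ f - C r * (C l * f) → r * l ≠ 1 →
      (X - C r) ^ n ∣ f := by
    intro r n hd hr
    have : f - C r * (C l * f) = C (1 - r * l) * f := by simp only [C_sub, C_mul, C_1]; ring
    rwa [this, IsUnit.dvd_mul_left (isUnit_C.2 (sub_ne_zero.2 (Ne.symm hr)).isUnit)] at hd
  by_cases hl : l = 0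
  · have := add_add_le_natDegree_of_dvd hf hp hq hpq h.dvd_zero (key h.dvd_fst (by simp [hl]))
      (key h.dvd_snd (by simp [hl]))
    omega
  have hg := h.natDegree_right_add_le (by simp [hl, hf])
  rw [natDegree_C_mul hl] at hg
  -- Here the constant field is (1, l); it is tangent to x = ry exactly when r l = 1.
  by_cases hpl : p * l = 1
  · have hql : q * l ≠ 1 := fun hh => hpq (mul_right_cancel₀ hl (hpl.trans hh.symm))
    have := add_le_natDegree_of_dvd hf hq h.dvd_zero (key h.dvd_snd hql)
    omega
  · have := add_le_natDegree_of_dvd hf hp h.dvd_zero (key h.dvd_fst hpl)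
    omega

theorem dvd_wronskian (h : IsLogPair p q a b c e d f g) (hp : p ≠ 0) (hq : q ≠ 0)
    (hpq : p ≠ q) :
    X ^ (a - 1) * (X - C p) ^ (c - 1) * (X - C q) ^ (e - 1) ∣ wronskian f g :=
  ((isCoprime_X_pow hq _ _).mul_left (isCoprime_sub_pow hpq _ _)).mul_dvd
    ((isCoprime_X_pow hp _ _).mul_dvd h.dvd_zero_wronskian h.dvd_fst_wronskian)
    h.dvd_snd_wronskian

/-- Compares the forced zeros of the Wronskian, a + c + e - 3 of them, with its degree, at most 2d -
b - 1. -/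
theorem sum_le [CharZero K] (h : IsLogPair p q a b c e d f g) (hp : p ≠ 0) (hq : q ≠ 0)
    (hpq : p ≠ q) (hw : wronskian f g ≠ 0) :
    a + b + c + e ≤ 2 * d + 2 := by
  have h1 := h.natDegree_wronskian_add_lt hw
  have h2 := add_add_le_natDegree_of_dvd hw hp hq hpq h.dvd_zero_wronskian h.dvd_fst_wronskian
    h.dvd_snd_wronskian
  omega

theorem reflect_X_sub_C_pow (r : K) (n : ℕ) (hr : r ≠ 0) :
    ∃ u : K[X], reflect n ((X - C r) ^ n) = u * (X - C r⁻¹) ^ n ∧ IsUnit u := by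
  refine ⟨C ((-r) ^ n), ?_, isUnit_C.2 (pow_ne_zero _ (neg_ne_zero.2 hr)).isUnit⟩
  rw [C_pow, ← mul_pow]
  have e : C (-r) * (X - C r⁻¹) = 1 - C r * X := by
    rw [mul_sub, ← C_mul, neg_mul, mul_inv_cancel₀ hr]; simp; ring
  rw [e]
  induction n with
  | zero => simp
  | succ n ih =>
    rw [pow_succ, reflect_mul _ _ (by simp) (natDegree_X_sub_C_le r), ih, pow_succ,
      reflect_sub, reflect_one_X, reflect_C, pow_one]

theorem reflect_dvd {r : K} (hr : r ≠ 0) {n d : ℕ} {u : K[X]} (hu : u.natDegree ≤ d)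
    (h : (X - C r) ^ n ∣ u) : (X - C r⁻¹) ^ n ∣ reflect d u := by
  obtain ⟨v, rfl⟩ := h
  by_cases hv : v = 0
  · simp [hv]
  have hd := (((monic_X_sub_C r).pow n).natDegree_mul' hv) ▸ hu
  simp only [natDegree_pow, natDegree_X_sub_C, mul_one] at hd
  obtain ⟨k, rfl⟩ := Nat.exists_eq_add_of_le hd
  obtain ⟨w, hw, -⟩ := reflect_X_sub_C_pow r n hr
  rw [add_assoc, reflect_mul _ v (by simp) (Nat.le_add_right _ _), hw]
  exact (Dvd.intro_left _ rfl).mul_right _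

/-- Exchange of the lines `x = 0` and `y = 0`. -/
theorem reflect_swap (h : IsLogPair p q a b c e d f g) (hp : p ≠ 0) (hq : q ≠ 0) :
    IsLogPair p⁻¹ q⁻¹ b a c e d (reflect d g) (reflect d f) where
  coeff_left i hi := by
    rw [coeff_reflect, revAt_eq_self_of_lt hi]; exact h.coeff_right _ (by omega)
  coeff_right i hi := by
    rw [coeff_reflect]
    rcases lt_or_ge d i with h1 | h1
    · rw [revAt_eq_self_of_lt h1, h.coeff_left _ h1]
    · rw [revAt_le h1]
      exact X_pow_dvd_iff.1 h.dvd_zero _ (by omega)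
  dvd_zero := X_pow_dvd_iff.2 fun i hi => by
    rw [coeff_reflect]
    rcases lt_or_ge d i with h1 | h1
    · rw [revAt_eq_self_of_lt h1]; exact h.coeff_right _ (by omega)
    · rw [revAt_le h1]; exact h.coeff_right _ (by omega)
  dvd_fst := by
    have := reflect_dvd hp (natDegree_sub_C_mul_le h p) h.dvd_fst
    rw [reflect_sub, reflect_C_mul] at this
    have e : reflect d g - C p⁻¹ * reflect d f
        = -C p⁻¹ * (reflect d f - C p * reflect d g) := by
      have : C p⁻¹ * C p = (1 : K[X]) := by rw [← C_mul, inv_mul_cancel₀ hp, C_1]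
      linear_combination -(reflect d g) * this
    rw [e]; exact this.mul_left _
  dvd_snd := by
    have := reflect_dvd hq (natDegree_sub_C_mul_le h q) h.dvd_snd
    rw [reflect_sub, reflect_C_mul] at this
    have e : reflect d g - C q⁻¹ * reflect d f
        = -C q⁻¹ * (reflect d f - C q * reflect d g) := by
      have : C q⁻¹ * C q = (1 : K[X]) := by rw [← C_mul, inv_mul_cancel₀ hq, C_1]
      linear_combination -(reflect d g) * this
    rw [e]; exact this.mul_left _

/-- Exchange of the lines `x = 0` and `x = p y` by the substitution `x ↦ p y - x`. -/
theorem comp_swap (h : IsLogPair p q a b c e d f g) (hb : b ≤ d) :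
    IsLogPair p (p - q) c b a e d ((C p * g - f).comp (C p - X)) (g.comp (C p - X)) where
  coeff_left i hi := by
    refine coeff_eq_zero_of_natDegree_lt (lt_of_le_of_lt natDegree_comp_le ?_)
    have h1 : (C p * g - f).natDegree ≤ d := by
      rw [← neg_sub, natDegree_neg]; exact h.natDegree_sub_C_mul_le p
    have h2 : (C p - X : K[X]).natDegree ≤ 1 := by
      rw [← neg_sub, natDegree_neg]; exact natDegree_X_sub_C_le p
    have := Nat.mul_le_mul h1 h2
    omega
  coeff_right i hi := by
    refine coeff_eq_zero_of_natDegree_lt (lt_of_le_of_lt natDegree_comp_le ?_)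
    -- `hb` keeps `d - b` from truncating: for b > d the vanishing is needed already at i = 0, which
    -- a bound on `natDegree` cannot express.
    have h1 : g.natDegree ≤ d - b := natDegree_le_iff_coeff_eq_zero.2 fun i hi =>
      h.coeff_right i (by omega)
    have h2 : (C p - X : K[X]).natDegree ≤ 1 := by
      rw [← neg_sub, natDegree_neg]; exact natDegree_X_sub_C_le p
    have := Nat.mul_le_mul h1 h2
    omega
  dvd_zero := by
    obtain ⟨u, hu⟩ := h.dvd_fst
    have : C p * g - f = (-1) * ((X - C p) ^ c * u) := by rw [← hu]; ring
    rw [this, mul_comp, mul_comp, pow_comp]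
    have e : (X - C p : K[X]).comp (C p - X) = -X := by simp
    rw [e, neg_pow]
    exact Dvd.dvd.mul_left (Dvd.dvd.mul_right (Dvd.intro_left _ rfl) _) _
  dvd_fst := by
    obtain ⟨u, rfl⟩ := h.dvd_zero
    simp only [sub_comp, mul_comp, C_comp, pow_comp, X_comp]
    have : C p - X = -(X - C p : K[X]) := by ring
    rw [show ∀ s t : K[X], s - t - s = -t by intros; ring, this, neg_pow]
    exact (Dvd.dvd.mul_right (Dvd.intro_left _ rfl) _).neg_right
  dvd_snd := by
    obtain ⟨u, hu⟩ := h.dvd_snd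
    have : (C p * g - f).comp (C p - X) - C (p - q) * g.comp (C p - X)
        = (-1) * (f - C q * g).comp (C p - X) := by
      simp only [sub_comp, mul_comp, C_comp, C_sub]; ring
    rw [this, hu, mul_comp, pow_comp]
    have e : (X - C q : K[X]).comp (C p - X) = -(X - C (p - q)) := by simp; ring
    rw [e, neg_pow]
    exact Dvd.dvd.mul_left (Dvd.dvd.mul_right (Dvd.intro_left _ rfl) _) _

/-- Normalization `p = 1` by scaling `x`. -/
theorem scale (h : IsLogPair p q a b c e d f g) (hp : p ≠ 0) :
    IsLogPair 1 (q / p) a b c e d (C p⁻¹ * f.comp (C p * X)) (g.comp (C p * X)) where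
  coeff_left i hi := by simp [comp_C_mul_X_coeff, h.coeff_left i hi]
  coeff_right i hi := by simp [comp_C_mul_X_coeff, h.coeff_right i hi]
  dvd_zero := X_pow_dvd_iff.2 fun i hi => by
    simp [comp_C_mul_X_coeff, X_pow_dvd_iff.1 h.dvd_zero i hi]
  dvd_fst := by
    obtain ⟨u, hu⟩ := h.dvd_fst
    have hpi : C p⁻¹ * C p = (1 : K[X]) := by rw [← C_mul, inv_mul_cancel₀ hp, C_1]
    have : C p⁻¹ * f.comp (C p * X) - C 1 * g.comp (C p * X)
        = C p⁻¹ * (f - C p * g).comp (C p * X) := by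
      simp only [sub_comp, mul_comp, C_comp, C_1]; linear_combination g.comp (C p * X) * hpi
    rw [this, hu, mul_comp, pow_comp]
    have e : (X - C p : K[X]).comp (C p * X) = C p * (X - C 1) := by simp; ring
    rw [e, mul_pow]
    exact Dvd.dvd.mul_left (Dvd.dvd.mul_right (Dvd.intro_left _ rfl) _) _
  dvd_snd := by
    obtain ⟨u, hu⟩ := h.dvd_snd
    have hpi : C p⁻¹ * C p = (1 : K[X]) := by rw [← C_mul, inv_mul_cancel₀ hp, C_1]
    have : C p⁻¹ * f.comp (C p * X) - C (q / p) * g.comp (C p * X)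
        = C p⁻¹ * (f - C q * g).comp (C p * X) := by
      simp only [sub_comp, mul_comp, C_comp, div_eq_mul_inv, C_mul]; ring
    rw [this, hu, mul_comp, pow_comp]
    have e : (X - C q : K[X]).comp (C p * X) = C p * (X - C (q / p)) := by
      rw [mul_sub, ← C_mul, mul_div_cancel₀ _ hp]; simp
    rw [e, mul_pow]
    exact Dvd.dvd.mul_left (Dvd.dvd.mul_right (Dvd.intro_left _ rfl) _) _

end Field

end IsLogPair

/-! ### Removing constant factors over a domain. -/

section Domain

variable {R : Type*} [CommRing R] [IsDomain R]

/-- The remainder modulo a monic polynomial is linear in the coefficients, so it vanishes as soon as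
a non-zero multiple of it does. -/
theorem dvd_of_monic_of_dvd_C_mul {Q v : R[X]} (hQ : Q.Monic) {r : R} (hr : r ≠ 0)
    (h : Q ∣ C r * v) : Q ∣ v := by
  rw [← modByMonic_eq_zero_iff_dvd hQ, ← smul_eq_C_mul, smul_modByMonic] at h
  rw [← modByMonic_eq_zero_iff_dvd hQ]
  exact (smul_eq_zero.1 h).resolve_left hr

theorem exists_eq_pow_mul_pair_and_not_dvd {M : Type*} [CommRing M] [IsDomain M] [WfDvdMonoid M]
    {r F G : M} (hr : ¬ IsUnit r) (h : F ≠ 0 ∨ G ≠ 0) :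
    ∃ n F₁ G₁, F = r ^ n * F₁ ∧ G = r ^ n * G₁ ∧ ¬ (r ∣ F₁ ∧ r ∣ G₁) := by
  classical
  have hex : ∃ n, ¬ (r ^ (n + 1) ∣ F ∧ r ^ (n + 1) ∣ G) := by
    rcases h with h | h
    · obtain ⟨n, hn⟩ := FiniteMultiplicity.of_not_isUnit hr h
      exact ⟨n, fun hh => hn hh.1⟩
    · obtain ⟨n, hn⟩ := FiniteMultiplicity.of_not_isUnit hr h
      exact ⟨n, fun hh => hn hh.2⟩
  have hdvd : r ^ Nat.find hex ∣ F ∧ r ^ Nat.find hex ∣ G := by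
    rcases Nat.eq_zero_or_pos (Nat.find hex) with h0 | h0
    · rw [h0]; simp
    · have := Nat.find_min hex (Nat.sub_lt h0 one_pos)
      rwa [not_not, Nat.sub_one_add_one h0.ne'] at this
  obtain ⟨⟨F₁, hF⟩, G₁, hG⟩ := hdvd
  refine ⟨_, F₁, G₁, hF, hG, fun hh => Nat.find_spec hex ?_⟩
  rw [pow_succ]
  constructor
  · conv_rhs => rw [hF]
    exact mul_dvd_mul_left _ hh.1
  · conv_rhs => rw [hG]
    exact mul_dvd_mul_left _ hh.2

end Domain

/-! ### Degree and leading coefficient in the parameter: in `R[X][X]` the outer variable is z, the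
inner one is t. -/

section Swap

variable {R : Type*} [CommRing R]

theorem coeff_coeff_swap (u : R[X][X]) (n i : ℕ) :
    ((Bivariate.swap u).coeff n).coeff i = (u.coeff i).coeff n := by
  induction u using Polynomial.induction_on' with
  | add p q hp hq => simp [hp, hq]
  | monomial k s =>
    induction s using Polynomial.induction_on' with
    | add p q hp hq => simp only [map_add, coeff_add, hp, hq]
    | monomial l r =>
      rw [Bivariate.swap_monomial_monomial]
      simp only [coeff_monomial]
      split_ifs <;> simp_all [coeff_monomial]

theorem coeff_swap_derivative (u : R[X][X]) (n : ℕ) :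
    (Bivariate.swap (derivative u)).coeff n = derivative ((Bivariate.swap u).coeff n) := by
  ext i
  rw [coeff_coeff_swap, coeff_derivative, coeff_derivative, coeff_coeff_swap]
  rw [← Nat.cast_add_one, ← Nat.cast_add_one, ← nsmul_eq_mul', ← nsmul_eq_mul', coeff_smul]

theorem natDegree_swap_derivative_le (u : R[X][X]) :
    (Bivariate.swap (derivative u)).natDegree ≤ (Bivariate.swap u).natDegree :=
  natDegree_le_iff_coeff_eq_zero.2 fun n hn => by
    rw [coeff_swap_derivative, coeff_eq_zero_of_natDegree_lt hn, derivative_zero]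

/-- Differentiation in z acts on each coefficient of a power of t separately, so passing to the top
coefficient in t, the value at t = ∞, commutes with the Wronskian. -/
theorem coeff_swap_wronskian (u v : R[X][X]) :
    (Bivariate.swap (wronskian u v)).coeff
        ((Bivariate.swap u).natDegree + (Bivariate.swap v).natDegree) =
      wronskian (Bivariate.swap u).leadingCoeff (Bivariate.swap v).leadingCoeff := by
  rw [wronskian, map_sub, map_mul, map_mul, coeff_sub,
    coeff_mul_add_eq_of_natDegree_le le_rfl (natDegree_swap_derivative_le v),
    coeff_mul_add_eq_of_natDegree_le (natDegree_swap_derivative_le u) le_rfl,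
    coeff_swap_derivative, coeff_swap_derivative]
  rfl

theorem natDegree_swap_wronskian [IsDomain R] {u v : R[X][X]}
    (h : wronskian (Bivariate.swap u).leadingCoeff (Bivariate.swap v).leadingCoeff ≠ 0) :
    (Bivariate.swap (wronskian u v)).natDegree =
      (Bivariate.swap u).natDegree + (Bivariate.swap v).natDegree := by
  refine le_antisymm ?_ (le_natDegree_of_ne_zero (by rwa [coeff_swap_wronskian]))
  rw [wronskian, map_sub, map_mul, map_mul]
  refine (natDegree_sub_le_of_le natDegree_mul_le natDegree_mul_le).trans (max_le ?_ ?_)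
  · have := natDegree_swap_derivative_le v; omega
  · have := natDegree_swap_derivative_le u; omega

theorem dvd_leadingCoeff_swap {P : R[X]} {u : R[X][X]} (h : P.map C ∣ u) :
    P ∣ (Bivariate.swap u).leadingCoeff := by
  have := map_dvd (Bivariate.swap (R := R)) h
  rw [Bivariate.swap_map_C, C_dvd_iff_dvd_coeff] at this
  exact this _

theorem coeff_leadingCoeff_swap {u : R[X][X]} {i : ℕ} (h : u.coeff i = 0) :
    ((Bivariate.swap u).leadingCoeff).coeff i = 0 := by
  rw [leadingCoeff, coeff_coeff_swap, h, coeff_zero]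

end Swap

/-! ### Families over the t-line: total t-degree, and the degeneration at t = 0. -/

section Parameter

variable {F : Type} [Field F]

/-- The Wronskian of two linearly independent sections that stay independent for all values
of the parameter, including infinity, determines the sum of their degrees in the parameter. -/
theorem natDegree_swap_add_natDegree_swap [CharZero F] {u v : F[X][X]} {a c e : ℕ}
    (hu : u.IsPrimitive) (hv : v.IsPrimitive)
    (hw : wronskian u v ≠ 0)
    (hQ : X ^ a * (X - C 1) ^ c * (X - C X) ^ e ∣ wronskian u v)
    (hdeg : (wronskian u v).natDegree ≤ a + c + e)
    (hred : ∀ (E : Type) [Field E] (φ : F[X] →+* E) (l : E), u.map φ ≠ 0 → v.map φ ≠ 0 →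
      v.map φ ≠ C l * u.map φ)
    (htop : ∀ l : F, (Bivariate.swap v).leadingCoeff ≠ C l * (Bivariate.swap u).leadingCoeff) :
    (∃ k : F, k ≠ 0 ∧
      wronskian u v = C (C k) * (X ^ a * (X - C 1) ^ c * (X - C X) ^ e)) ∧
    (Bivariate.swap u).natDegree + (Bivariate.swap v).natDegree = e := by
  have hmon : (X ^ a * (X - C 1) ^ c * (X - C X) ^ e : F[X][X]).Monic :=
    ((monic_X_pow a).mul ((monic_X_sub_C 1).pow c)).mul ((monic_X_sub_C X).pow e)
  have hQdeg : (X ^ a * (X - C 1) ^ c * (X - C X) ^ e : F[X][X]).natDegree = a + c + e := by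
    rw [(((monic_X_pow a).mul ((monic_X_sub_C (1 : F[X])).pow c))).natDegree_mul
      ((monic_X_sub_C X).pow e), (monic_X_pow a).natDegree_mul ((monic_X_sub_C 1).pow c)]
    simp only [natDegree_pow, natDegree_X, natDegree_X_sub_C, mul_one]
  obtain ⟨w, hwQ⟩ := hQ
  have hw0 : w ≠ 0 := by rintro rfl; simp [hwQ] at hw
  have hwd : w.natDegree = 0 := by
    rw [hwQ, hmon.natDegree_mul' hw0, hQdeg] at hdeg; omega
  rw [eq_C_of_natDegree_eq_zero hwd] at hwQ hw0
  generalize w.coeff 0 = k at hwQ hw0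
  have hk0 : k ≠ 0 := fun h => hw0 (by rw [h, C_0])
  -- At a root of `k` the Wronskian vanishes, so the reductions of `u` and `v` over the residue
  -- field, non-zero by primitivity, would be proportional, against `hred`.
  have hunit : IsUnit k := by
    by_contra hk
    obtain ⟨π, hπ, hdvd⟩ := WfDvdMonoid.exists_irreducible_factor hk hk0
    have : Fact (Irreducible π) := ⟨hπ⟩
    have : CharZero (AdjoinRoot π) := charZero_of_injective_algebraMap
      (algebraMap F (AdjoinRoot π)).injective
    have hne : ∀ s : F[X][X], s.IsPrimitive → s.map (AdjoinRoot.mk π) ≠ 0 := by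
      intro s hs h0
      refine hπ.not_isUnit (hs π (C_dvd_iff_dvd_coeff _ _ |>.2 fun i => ?_))
      rw [← AdjoinRoot.mk_eq_zero, ← coeff_map, h0, coeff_zero]
    have hW : wronskian (u.map (AdjoinRoot.mk π)) (v.map (AdjoinRoot.mk π)) = 0 := by
      rw [← wronskian_map, hwQ, Polynomial.map_mul, map_C, AdjoinRoot.mk_eq_zero.2 hdvd, C_0,
        mul_zero]
    obtain ⟨l, hl⟩ := exists_eq_C_mul_of_wronskian_eq_zero (hne u hu) hW
    exact hred _ _ l (hne u hu) (hne v hv) hl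
  obtain ⟨k, hk, rfl⟩ := Polynomial.isUnit_iff.1 hunit
  rw [mul_comm] at hwQ
  refine ⟨⟨k, hk.ne_zero, hwQ⟩, ?_⟩
  have hu0 : (Bivariate.swap u).leadingCoeff ≠ 0 := by
    rw [Ne, leadingCoeff_eq_zero, EmbeddingLike.map_eq_zero_iff]; exact hu.ne_zero
  -- Independence at t = ∞ makes the t-degree of the Wronskian the sum of those of `u` and `v`; it
  -- is read off from the product, where only (z-t)^e involves t.
  rw [← natDegree_swap_wronskian fun h0 =>
    (exists_eq_C_mul_of_wronskian_eq_zero hu0 h0).elim htop, hwQ]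
  have e1 : Bivariate.swap (C (C k) * (X ^ a * (X - C 1) ^ c * (X - C X) ^ e : F[X][X]))
      = C (C k * X ^ a * (X - 1) ^ c) * ((-1) ^ e * (X - C X) ^ e) := by
    rw [← mul_pow]
    simp only [map_mul, map_pow, map_sub, Bivariate.swap_X, Bivariate.swap_Y, Bivariate.swap_C_C,
      map_one]
    ring
  have hne : (C k * X ^ a * (X - 1) ^ c : F[X]) ≠ 0 :=
    mul_ne_zero (mul_ne_zero (C_ne_zero.2 hk.ne_zero) (pow_ne_zero _ X_ne_zero))
      (pow_ne_zero _ (by simpa using X_sub_C_ne_zero (1 : F)))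
  rw [e1, natDegree_C_mul hne]
  rcases neg_one_pow_eq_or F[X][X] e with h | h
  · rw [h, one_mul, natDegree_pow, natDegree_X_sub_C, mul_one]
  · rw [h, neg_one_mul, natDegree_neg, natDegree_pow, natDegree_X_sub_C, mul_one]

theorem C_X_dvd_of_map_eval_zero {u : F[X][X]} (h : u.map (evalRingHom 0) = 0) : C X ∣ u :=
  (C_dvd_iff_dvd_coeff _ _).2 fun i => by
    rw [X_dvd_iff, coeff_zero_eq_eval_zero, ← coe_evalRingHom, ← coeff_map, h, coeff_zero]

/-- Degeneration at `t = 0`, where the lines `x = 0` and `x = t y` collide, after the rescaling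
`x = t X`. -/
theorem exists_X_pow_dvd_coeff_zero [CharZero F] {f g : F[X][X]} {a e : ℕ} (hfg : f ≠ 0 ∨ g ≠ 0)
    (ha : 1 ≤ a) (hea : e ≤ a) (hf : X ^ a ∣ f) (hfg' : (X - C X) ^ e ∣ f - C X * g) :
    ∃ n, 1 ≤ n ∧ X ^ (n - 1) ∣ g.coeff 0 ∧ (a + e ≤ 2 * n ∨ e + 1 ≤ n) := by
  have hcomp : ∀ (s : F[X][X]) i, (s.comp (C X * X)).coeff i = s.coeff i * X ^ i :=
    fun s i => comp_C_mul_X_coeff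
  have hcomp0 : ∀ s : F[X][X], s ≠ 0 → s.comp (C X * X) ≠ 0 := by
    intro s hs h0
    refine hs (ext fun i => ?_)
    have := hcomp s i
    rw [h0, coeff_zero] at this
    simpa using this.symm
  have hCX : ¬ IsUnit (C X : F[X][X]) := by
    rw [isUnit_C]; exact not_isUnit_X
  -- In the coordinate x/t the derivation has components f/t and g, proportional to f and t g. The
  -- exponent `n` is the order at t = 0 of this rescaled pair, and `F₁`, `G₁` at t = 0 give its
  -- non-zero limit.
  obtain ⟨n, F₁, G₁, hF, hG, hnd⟩ := exists_eq_pow_mul_pair_and_not_dvd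
    (F := f.comp (C X * X)) (G := C X * g.comp (C X * X)) hCX
    (hfg.imp (hcomp0 f) fun h => mul_ne_zero (by simp) (hcomp0 g h))
  rw [← C_pow] at hF hG
  have hFc : ∀ i, f.coeff i * X ^ i = X ^ n * F₁.coeff i := fun i => by
    rw [← hcomp, hF, coeff_C_mul]
  have hGc : ∀ i, g.coeff i * X ^ (i + 1) = X ^ n * G₁.coeff i := fun i => by
    rw [← coeff_C_mul, ← hG, coeff_C_mul, hcomp]; ring
  have hn1 : 1 ≤ n := by
    by_contra hn
    obtain rfl : n = 0 := by omega
    refine hnd ⟨(C_dvd_iff_dvd_coeff _ _).2 fun i => ?_, (C_dvd_iff_dvd_coeff _ _).2 fun i => ?_⟩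
    · have := hFc i
      rw [pow_zero, one_mul] at this
      rw [← this]
      rcases Nat.eq_zero_or_pos i with rfl | hi
      · rw [X_pow_dvd_iff.1 hf 0 (by omega)]; simp
      · exact (dvd_pow_self _ hi.ne').mul_left _
    · have := hGc i
      rw [pow_zero, one_mul] at this
      rw [← this, pow_succ]
      exact Dvd.intro_left _ (mul_assoc _ _ _)
  refine ⟨n, hn1, ?_, ?_⟩
  · have := hGc 0
    obtain ⟨k, rfl⟩ := Nat.exists_eq_add_of_le' hn1
    rw [zero_add, pow_one, pow_succ, mul_right_comm] at this
    exact ⟨_, mul_right_cancel₀ X_ne_zero this⟩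
  have hXn : (X ^ n : F[X]) ≠ 0 := pow_ne_zero _ X_ne_zero
  set ev := evalRingHom (0 : F) with hev
  have hF0 : F₁.map ev ≠ 0 ∨ G₁.map ev ≠ 0 := by
    by_contra! h
    exact hnd ⟨C_X_dvd_of_map_eval_zero h.1, C_X_dvd_of_map_eval_zero h.2⟩
  have hXdvd : X ^ a ∣ F₁.map ev := X_pow_dvd_iff.2 fun i hi => by
    have := hFc i
    rw [X_pow_dvd_iff.1 hf i hi, zero_mul, eq_comm, mul_eq_zero] at this
    rw [coeff_map, this.resolve_left hXn, map_zero]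
  have h1dvd : (X - C 1) ^ e ∣ F₁.map ev - G₁.map ev := by
    have h1 : (X - C 1) ^ e ∣ C (X ^ n) * (F₁ - G₁) := by
      rw [mul_sub, ← hF, ← hG]
      obtain ⟨w, hw⟩ := hfg'
      have : f.comp (C X * X) - C X * g.comp (C X * X)
          = (C X * (X - C 1)) ^ e * w.comp (C X * X) := by
        rw [show f.comp (C X * X) - C X * g.comp (C X * X) = (f - C X * g).comp (C X * X) by simp,
          hw, mul_comp, pow_comp]
        congr 2
        simp only [sub_comp, X_comp, C_comp, C_1]; ring
      rw [this, mul_pow]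
      exact (Dvd.intro_left _ rfl).mul_right _
    have := Polynomial.map_dvd ev
      (dvd_of_monic_of_dvd_C_mul ((monic_X_sub_C (1 : F[X])).pow e) hXn h1)
    simpa using this
  -- The coefficient of z^i acquires t^i, so after division by t^n it still vanishes at t = 0 when i
  -- > n. For `G₁` the extra factor t lowers the bound to n - 1.
  have hFdeg : (F₁.map ev).natDegree ≤ n := natDegree_le_iff_coeff_eq_zero.2 fun i hi => by
    obtain ⟨k, rfl⟩ := Nat.exists_eq_add_of_lt hi
    have := hFc (n + k + 1)
    rw [add_assoc, pow_add, mul_left_comm] at this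
    rw [coeff_map, add_assoc, ← mul_left_cancel₀ hXn this, hev]
    simp
  have hGdeg : (G₁.map ev).natDegree ≤ n - 1 := natDegree_le_iff_coeff_eq_zero.2 fun i hi => by
    obtain ⟨k, rfl⟩ := Nat.exists_eq_add_of_le (show n ≤ i by omega)
    have := hGc (n + k)
    rw [add_assoc, pow_add, mul_left_comm] at this
    rw [coeff_map, ← mul_left_cancel₀ hXn this, hev]
    simp
  generalize F₁.map ev = F₀ at *
  generalize G₁.map ev = G₀ at *
  by_cases hW : wronskian F₀ G₀ = 0
  · by_cases hF00 : F₀ = 0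
    · subst hF00
      have hG0 : G₀ ≠ 0 := by simpa using hF0
      rw [zero_sub, dvd_neg] at h1dvd
      have := natDegree_le_of_dvd h1dvd hG0
      rw [natDegree_pow, natDegree_X_sub_C] at this
      omega
    obtain ⟨l, rfl⟩ := exists_eq_C_mul_of_wronskian_eq_zero hF00 hW
    by_cases hl : l = 1
    · subst hl
      have := natDegree_le_of_dvd hXdvd hF00
      rw [natDegree_pow, natDegree_X] at this
      rw [C_1, one_mul] at hGdeg
      omega
    · have h2 : (X - C 1) ^ e ∣ F₀ := by
        rwa [show F₀ - C l * F₀ = C (1 - l) * F₀ by simp only [C_sub, C_1]; ring,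
          IsUnit.dvd_mul_left (isUnit_C.2 (sub_ne_zero.2 (Ne.symm hl)).isUnit)] at h1dvd
      have := IsLogPair.add_le_natDegree_of_dvd hF00 one_ne_zero hXdvd h2
      omega
  · have h1 := natDegree_wronskian_lt_add hW
    have h2 := IsLogPair.add_le_natDegree_of_dvd hW one_ne_zero (pow_sub_one_dvd_wronskian hXdvd G₀)
      (by
        have := pow_sub_one_dvd_wronskian h1dvd G₀
        have e1 := wronskian_sub_C_mul_left 1 F₀ G₀
        rw [C_1, one_mul] at e1
        rwa [e1] at this)
    omega

end Parameter

/-! ### Primitive parts, change of coefficients, and independence after specialization. -/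

section PrimitivePart

theorem exists_isPrimitive_eq_C_mul {R : Type*} [CommRing R] [IsDomain R]
    [UniqueFactorizationMonoid R] {u : R[X]} (hu : u ≠ 0) :
    ∃ (r : R) (v : R[X]), r ≠ 0 ∧ v.IsPrimitive ∧ u = C r * v := by
  classical
  let := (UniqueFactorizationMonoid.strongNormalizationMonoid : StrongNormalizationMonoid R)
  let := UniqueFactorizationMonoid.toNormalizedGCDMonoid R
  exact ⟨u.content, u.primPart, fun h => hu (content_eq_zero_iff.1 h), u.isPrimitive_primPart,
    u.eq_C_content_mul_primPart⟩

theorem wronskian_primitive {R : Type*} [CommRing R] [IsDomain R] {u v Q : R[X]} {r s : R}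
    (hr : r ≠ 0) (hs : s ≠ 0) (hQ : Q.Monic) {n : ℕ}
    (hw : wronskian (C r * u) (C s * v) ≠ 0) (hdvd : Q ∣ wronskian (C r * u) (C s * v))
    (hdeg : (wronskian (C r * u) (C s * v)).natDegree ≤ n) :
    wronskian u v ≠ 0 ∧ Q ∣ wronskian u v ∧ (wronskian u v).natDegree ≤ n := by
  rw [wronskian_C_mul_left, wronskian_C_mul_right] at hw hdvd hdeg
  refine ⟨fun h => hw (by rw [h, mul_zero, mul_zero]),
    dvd_of_monic_of_dvd_C_mul hQ hs (dvd_of_monic_of_dvd_C_mul hQ hr hdvd), ?_⟩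
  rwa [natDegree_C_mul hr, natDegree_C_mul hs] at hdeg

end PrimitivePart

namespace IsLogPair

theorem of_C_mul {R : Type*} [CommRing R] [IsDomain R] {p q r : R} (hr : r ≠ 0)
    {a b c e d : ℕ} {f g : R[X]} (h : IsLogPair p q a b c e d (C r * f) (C r * g)) :
    IsLogPair p q a b c e d f g where
  coeff_left i hi := by simpa [hr] using h.coeff_left i hi
  coeff_right i hi := by simpa [hr] using h.coeff_right i hi
  dvd_zero := dvd_of_monic_of_dvd_C_mul (monic_X_pow a) hr h.dvd_zero
  dvd_fst := dvd_of_monic_of_dvd_C_mul ((monic_X_sub_C p).pow c) hr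
    (by have := h.dvd_fst; rwa [mul_left_comm, ← mul_sub] at this)
  dvd_snd := dvd_of_monic_of_dvd_C_mul ((monic_X_sub_C q).pow e) hr
    (by have := h.dvd_snd; rwa [mul_left_comm, ← mul_sub] at this)

theorem of_map {R S : Type*} [CommRing R] [CommRing S] {φ : R →+* S}
    (hφ : Function.Injective φ) {p q : R} {a b c e d : ℕ} {f g : R[X]}
    (h : IsLogPair (φ p) (φ q) a b c e d (f.map φ) (g.map φ)) :
    IsLogPair p q a b c e d f g where
  coeff_left i hi := hφ (by simpa using h.coeff_left i hi)
  coeff_right i hi := hφ (by simpa using h.coeff_right i hi)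
  dvd_zero := (map_dvd_map φ hφ (monic_X_pow a)).1 (by simpa using h.dvd_zero)
  dvd_fst := (map_dvd_map φ hφ ((monic_X_sub_C p).pow c)).1 (by simpa using h.dvd_fst)
  dvd_snd := (map_dvd_map φ hφ ((monic_X_sub_C q).pow e)).1 (by simpa using h.dvd_snd)

section Proportional

variable {E : Type*} [Field E] {a b c d : ℕ} {l : E} {s t : E[X]}

/-- A common multiple would have too many zeros on two of the lines z = 0, 1, ∞. This and the next
two lemmas treat the three pairs among u, v, w, at every residue field and at t = ∞. -/
theorem ne_C_mul_of_dvd_zero_of_coeff (hab : d < a + b) (hs : X ^ a ∣ s)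
    (ht : ∀ i, d < i + b → t.coeff i = 0) (hs0 : s ≠ 0) (ht0 : t ≠ 0) : t ≠ C l * s := by
  rintro rfl
  have hl : l ≠ 0 := by rintro rfl; simp at ht0
  have h1 := natDegree_le_of_dvd hs hs0
  rw [natDegree_X_pow] at h1
  exact ht0 (leadingCoeff_eq_zero.1 (ht _ (by rw [natDegree_C_mul hl]; omega)))

theorem ne_C_mul_of_dvd_zero_of_dvd_one (hac : d < a + c) (hs : X ^ a ∣ s)
    (ht : (X - C 1) ^ c ∣ t) (htd : ∀ i, d < i → t.coeff i = 0) (ht0 : t ≠ 0) :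
    t ≠ C l * s := by
  rintro rfl
  have := add_le_natDegree_of_dvd ht0 one_ne_zero (hs.mul_left _) ht
  have := natDegree_le_iff_coeff_eq_zero.2 htd
  omega

theorem ne_C_mul_of_coeff_of_dvd_one (hbc : d < b + c) (hs : ∀ i, d < i + b → s.coeff i = 0)
    (ht : (X - C 1) ^ c ∣ t) (ht0 : t ≠ 0) : t ≠ C l * s := by
  rintro rfl
  have hl : l ≠ 0 := by rintro rfl; simp at ht0
  have h1 := natDegree_le_of_dvd ht ht0
  rw [natDegree_pow, natDegree_X_sub_C, natDegree_C_mul hl] at h1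
  exact ht0 (by rw [leadingCoeff_eq_zero.1 (hs _ (by omega)), mul_zero])

end Proportional

/-- The factors are not comaximal over `F[X]`, since lines collide at t = 0 and t = 1. The
divisibility is proved over the fraction field and descends because the product is monic. -/
theorem dvd_wronskian_polynomial {F : Type*} [Field F] {a b c e d : ℕ} {f g : F[X][X]}
    (h : IsLogPair 1 X a b c e d f g) :
    X ^ (a - 1) * (X - C 1) ^ (c - 1) * (X - C X) ^ (e - 1) ∣ wronskian f g := by
  have hinj := IsFractionRing.injective F[X] (FractionRing F[X])
  have hmon : (X ^ (a - 1) * (X - C 1) ^ (c - 1) * (X - C X) ^ (e - 1) : F[X][X]).Monic :=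
    ((monic_X_pow _).mul ((monic_X_sub_C 1).pow _)).mul ((monic_X_sub_C X).pow _)
  refine (map_dvd_map _ hinj hmon).1 ?_
  have := (h.map (algebraMap F[X] (FractionRing F[X]))).dvd_wronskian (by simp)
    ((map_ne_zero_iff _ hinj).2 X_ne_zero) (fun h => X_ne_C (1 : F) (hinj h).symm)
  rw [wronskian_map]
  simpa using this

theorem wronskian_ne_zero_polynomial {F : Type*} [Field F] [CharZero F] {a b c e d : ℕ}
    {f g : F[X][X]} (h : IsLogPair 1 X a b c e d f g) (hfg : f ≠ 0 ∨ g ≠ 0)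
    (h1 : d < b + c + e) (h2 : d < a + c + e) (h3 : d < a + b + e) (h4 : d < a + b + c) :
    wronskian f g ≠ 0 := by
  have hinj := IsFractionRing.injective F[X] (FractionRing F[X])
  have : CharZero (FractionRing F[X]) := charZero_of_injective_algebraMap hinj
  have := (h.map (algebraMap F[X] (FractionRing F[X]))).wronskian_ne_zero (by simp)
    ((map_ne_zero_iff _ hinj).2 X_ne_zero) (fun h => X_ne_C (1 : F) (hinj h).symm)
    (hfg.imp (Polynomial.map_ne_zero_iff hinj).2 (Polynomial.map_ne_zero_iff hinj).2) h1 h2 h3 h4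
  rw [← wronskian_map] at this
  exact fun h0 => this (by rw [h0, Polynomial.map_zero])

/-! ### The contradiction for the generic family. -/

section Generic

variable {F : Type} [Field F] [CharZero F] {a b c e d : ℕ}

theorem eq_zero_polynomial_of_not_dvd {f g : F[X][X]} (h : IsLogPair 1 X a b c e d f g)
    (hnd : ¬ (C X ∣ f ∧ C X ∣ g)) (hsum : a + b + c + e = 2 * d + 2) (he : 1 ≤ e) (heb : e ≤ b)
    (hec : e ≤ c) (hba : b ≤ a) (hca : c ≤ a) (had : a ≤ d) (ha : 2 ≤ a) : False := by
  have hfg : f ≠ 0 ∨ g ≠ 0 := by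
    by_contra! h0
    exact hnd (by simp [h0.1, h0.2])
  have hw := h.wronskian_ne_zero_polynomial hfg (by omega) (by omega) (by omega) (by omega)
  have hQ := h.dvd_wronskian_polynomial
  have hdeg : (wronskian f g).natDegree ≤ (a - 1) + (c - 1) + (e - 1) := by
    have := h.natDegree_wronskian_add_lt hw; omega
  have hmon : (X ^ (a - 1) * (X - C 1) ^ (c - 1) * (X - C X) ^ (e - 1) : F[X][X]).Monic :=
    ((monic_X_pow _).mul ((monic_X_sub_C 1).pow _)).mul ((monic_X_sub_C X).pow _)
  have hf0 : f ≠ 0 := by rintro rfl; simp at hw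
  have hg0 : g ≠ 0 := by rintro rfl; simp at hw
  have hfg0 : f - g ≠ 0 := fun h0 => hw (by rw [sub_eq_zero.1 h0, wronskian_self_eq_zero])
  obtain ⟨r, u, hr, hu, rfl⟩ := exists_isPrimitive_eq_C_mul hf0
  obtain ⟨s, v, hs, hv, rfl⟩ := exists_isPrimitive_eq_C_mul hg0
  obtain ⟨x, w, hx, hwp, hh⟩ := exists_isPrimitive_eq_C_mul hfg0
  have hlc : ∀ z : F[X][X], z.IsPrimitive → (Bivariate.swap z).leadingCoeff ≠ 0 := fun z hz => by
    rw [Ne, leadingCoeff_eq_zero, EmbeddingLike.map_eq_zero_iff]; exact hz.ne_zero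
  have hua : X ^ a ∣ u := dvd_of_monic_of_dvd_C_mul (monic_X_pow a) hr h.dvd_zero
  have hvb : ∀ i, d < i + b → v.coeff i = 0 := fun i hi => by
    have := h.coeff_right i hi
    rw [coeff_C_mul] at this
    exact (mul_eq_zero.1 this).resolve_left hs
  have hwc : (X - C 1) ^ c ∣ w := by
    have := h.dvd_fst
    rw [C_1, one_mul, hh] at this
    rw [C_1]
    exact dvd_of_monic_of_dvd_C_mul ((monic_X_sub_C 1).pow c) hx this
  have hwd : ∀ i, d < i → w.coeff i = 0 := fun i hi => by
    have := congrArg (fun z => z.coeff i) hh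
    simp only [coeff_sub, h.coeff_left i hi, h.coeff_right i (by omega), sub_zero] at this
    rw [coeff_C_mul] at this
    exact (mul_eq_zero.1 this.symm).resolve_left hx
  have hua' : X ^ a ∣ (Bivariate.swap u).leadingCoeff := dvd_leadingCoeff_swap (by simpa using hua)
  have hwc' : (X - C 1) ^ c ∣ (Bivariate.swap w).leadingCoeff :=
    dvd_leadingCoeff_swap (by simpa using hwc)
  have mapX : ∀ {E : Type} [Field E] (φ : F[X] →+* E), X ^ a ∣ u.map φ := fun φ => by
    simpa using Polynomial.map_dvd φ hua
  have map1 : ∀ {E : Type} [Field E] (φ : F[X] →+* E), (X - C 1) ^ c ∣ w.map φ := fun φ => by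
    simpa using Polynomial.map_dvd φ hwc
  have hab : d < a + b := by omega
  have hac : d < a + c := by omega
  have huv : (∃ k : F, k ≠ 0 ∧ wronskian u v =
        C (C k) * (X ^ (a - 1) * (X - C 1) ^ (c - 1) * (X - C X) ^ (e - 1))) ∧
      (Bivariate.swap u).natDegree + (Bivariate.swap v).natDegree = e - 1 := by
    obtain ⟨w1, w2, w3⟩ := wronskian_primitive hr hs hmon hw hQ hdeg
    exact natDegree_swap_add_natDegree_swap hu hv w1 w2 w3
      (fun E _ φ l h1 h2 => ne_C_mul_of_dvd_zero_of_coeff hab (mapX φ)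
        (fun i hi => by rw [coeff_map, hvb i hi, map_zero]) h1 h2)
      (fun l => ne_C_mul_of_dvd_zero_of_coeff hab hua'
        (fun i hi => coeff_leadingCoeff_swap (hvb i hi)) (hlc u hu) (hlc v hv))
  obtain ⟨⟨k, hk, hW⟩, hdeg_uv⟩ := huv
  -- If the content of g vanished at t = 0, then at t = 0 the polynomial f would have a + c > d
  -- zeros and vanish too, against `hnd`.
  have hXs : ¬ X ∣ s := by
    intro hXs
    have hg' : (C s * v).map (evalRingHom (0 : F)) = 0 := by
      rw [Polynomial.map_mul, map_C, coe_evalRingHom, ← coeff_zero_eq_eval_zero, X_dvd_iff.1 hXs,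
        C_0, zero_mul]
    have hf' : (C r * u).map (evalRingHom (0 : F)) ≠ 0 := fun h0 =>
      hnd ⟨C_X_dvd_of_map_eval_zero h0, C_X_dvd_of_map_eval_zero hg'⟩
    have hm := h.map (evalRingHom (0 : F))
    rw [hg'] at hm
    have h1 := hm.dvd_fst
    rw [mul_zero, sub_zero, map_one] at h1
    have := add_le_natDegree_of_dvd hf' one_ne_zero hm.dvd_zero h1
    have := hm.natDegree_left_le
    omega
  obtain ⟨n, hn1, hdvd, hn⟩ := exists_X_pow_dvd_coeff_zero hfg (by omega) (by omega) h.dvd_zero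
    h.dvd_snd
  rw [coeff_C_mul] at hdvd
  have hdvd' := prime_X.pow_dvd_of_dvd_mul_left _ hXs hdvd
  have hlt : (Bivariate.swap v).natDegree < n - 1 := by
    by_cases hen : e + 1 ≤ n
    · omega
    -- Now n ≤ e and a + e ≤ 2n force a = b = c = e, hence b + c = d + 1. The pairs (u, w) and (v,
    -- w) then give their own degree equations, and all three t-degrees equal (e - 1)/2, which is
    -- below n - 1 because a ≥ 2.
    have hbc : d < b + c := by omega
    have hxu : wronskian (C r * u) (C x * w) = - wronskian (C r * u) (C s * v) := by
      rw [← hh, sub_eq_add_neg, wronskian_add_right, wronskian_self_eq_zero, wronskian_neg_right,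
        zero_add]
    have hxv : wronskian (C s * v) (C x * w) = - wronskian (C r * u) (C s * v) := by
      rw [← hh, sub_eq_add_neg, wronskian_add_right, wronskian_neg_right, wronskian_self_eq_zero,
        neg_zero, add_zero, wronskian_neg_eq]
    have huw : (Bivariate.swap u).natDegree + (Bivariate.swap w).natDegree = e - 1 := by
      obtain ⟨w1, w2, w3⟩ := wronskian_primitive hr hx hmon (by rw [hxu, neg_ne_zero]; exact hw)
        (by rw [hxu, dvd_neg]; exact hQ) (n := (a - 1) + (c - 1) + (e - 1))
        (by rw [hxu, natDegree_neg]; exact hdeg)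
      exact (natDegree_swap_add_natDegree_swap hu hwp w1 w2 w3
        (fun E _ φ l _ h2 => ne_C_mul_of_dvd_zero_of_dvd_one hac (mapX φ) (map1 φ)
          (fun i hi => by rw [coeff_map, hwd i hi, map_zero]) h2)
        (fun l => ne_C_mul_of_dvd_zero_of_dvd_one hac hua' hwc'
          (fun i hi => coeff_leadingCoeff_swap (hwd i hi)) (hlc w hwp))).2
    have hvw : (Bivariate.swap v).natDegree + (Bivariate.swap w).natDegree = e - 1 := by
      obtain ⟨w1, w2, w3⟩ := wronskian_primitive hs hx hmon (by rw [hxv, neg_ne_zero]; exact hw)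
        (by rw [hxv, dvd_neg]; exact hQ) (n := (a - 1) + (c - 1) + (e - 1))
        (by rw [hxv, natDegree_neg]; exact hdeg)
      exact (natDegree_swap_add_natDegree_swap hv hwp w1 w2 w3
        (fun E _ φ l _ h2 => ne_C_mul_of_coeff_of_dvd_one hbc
          (fun i hi => by rw [coeff_map, hvb i hi, map_zero]) (map1 φ) h2)
        (fun l => ne_C_mul_of_coeff_of_dvd_one hbc
          (fun i hi => coeff_leadingCoeff_swap (hvb i hi)) hwc' (hlc w hwp))).2
    omega
  have hv0 : v.coeff 0 = 0 := by
    by_contra hne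
    have h1 := natDegree_le_of_dvd hdvd' hne
    rw [natDegree_X_pow] at h1
    refine hne (leadingCoeff_eq_zero.1 ?_)
    rw [leadingCoeff, ← coeff_coeff_swap,
      coeff_eq_zero_of_natDegree_lt (hlt.trans_le h1), coeff_zero]
  -- In u v' - u' v the factor u' has order at least a - 1 at z = 0, and v(0) = 0 supplies one more.
  have hXW : X ^ a ∣ wronskian u v := by
    refine dvd_sub (hua.mul_right _) ?_
    have h1 := pow_sub_one_dvd_derivative_of_pow_dvd hua
    have h2 := mul_dvd_mul h1 (X_dvd_iff.2 hv0)
    rwa [← pow_succ, Nat.sub_add_cancel (by omega)] at h2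
  rw [hW] at hXW
  have e1 : C (C k) * (X ^ (a - 1) * (X - C 1) ^ (c - 1) * (X - C X) ^ (e - 1)) =
      (X ^ (a - 1) * (C (C k) * ((X - C 1) ^ (c - 1) * (X - C X) ^ (e - 1))) : F[X][X]) := by ring
  rw [e1, show a = a - 1 + 1 by omega, pow_succ, Nat.add_sub_cancel,
    mul_dvd_mul_iff_left (pow_ne_zero _ X_ne_zero), X_dvd_iff, coeff_zero_eq_eval_zero] at hXW
  simp [hk] at hXW

theorem eq_zero_polynomial {f g : F[X][X]} (h : IsLogPair 1 X a b c e d f g)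
    (hsum : a + b + c + e = 2 * d + 2) (he : 1 ≤ e) (heb : e ≤ b)
    (hec : e ≤ c) (hba : b ≤ a) (hca : c ≤ a) (had : a ≤ d) (ha : 2 ≤ a) : f = 0 ∧ g = 0 := by
  by_contra hfg
  obtain ⟨n, f, g, rfl, rfl, hnd⟩ := exists_eq_pow_mul_pair_and_not_dvd (r := C X)
    (by rw [isUnit_C]; exact not_isUnit_X) (not_and_or.1 hfg)
  rw [← C_pow] at h
  exact (h.of_C_mul (pow_ne_zero _ X_ne_zero)).eq_zero_polynomial_of_not_dvd hnd hsum he heb hec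
    hba hca had ha

end Generic

end IsLogPair

/-! ### Descent from `K` to `F(t)` and to `F[t]`. -/

section Descent

/-- Applying an `L`-linear functional `K → L` to the coefficients of a polynomial. -/
theorem exists_addMonoidHom_coeff {L K : Type*} [Field L] [Field K] [Algebra L K] (ℓ : K →ₗ[L] L) :
    ∃ Φ : K[X] →+ L[X], (∀ p i, (Φ p).coeff i = ℓ (p.coeff i)) ∧
      ∀ (s : L[X]) p, Φ (s.map (algebraMap L K) * p) = s * Φ p := by
  have hc : ∀ (p : K[X]) i,
      (∑ j ∈ Finset.range (p.natDegree + 1), monomial j (ℓ (p.coeff j))).coeff i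
        = ℓ (p.coeff i) := by
    intro p i
    rw [finsetSum_coeff]
    simp only [coeff_monomial]
    rw [Finset.sum_ite_eq']
    split_ifs with h
    · rfl
    · rw [coeff_eq_zero_of_natDegree_lt (by simpa using h), map_zero]
  let Φ : K[X] →+ L[X] :=
    { toFun p := ∑ j ∈ Finset.range (p.natDegree + 1), monomial j (ℓ (p.coeff j))
      map_zero' := ext fun i => by rw [hc]; simp
      map_add' p q := ext fun i => by rw [coeff_add, hc, hc, hc, coeff_add, map_add] }
  have hΦ : ∀ p i, (Φ p).coeff i = ℓ (p.coeff i) := hc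
  refine ⟨Φ, hΦ, fun s p => ext fun i => ?_⟩
  rw [hΦ, coeff_mul, coeff_mul, map_sum]
  refine Finset.sum_congr rfl fun x _ => ?_
  rw [coeff_map, ← Algebra.smul_def, map_smul, smul_eq_mul, hΦ]

namespace IsLogPair

variable {a b c e d : ℕ}

/-- The defining conditions are linear over `L`, so an `L`-linear functional applied to the
coefficients preserves them. It is chosen not to kill a non-zero coefficient. -/
theorem exists_descent {L K : Type*} [Field L] [Field K] [Algebra L K] {p q : L} {f g : K[X]}
    (h : IsLogPair (algebraMap L K p) (algebraMap L K q) a b c e d f g) (hfg : f ≠ 0 ∨ g ≠ 0) :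
    ∃ f' g' : L[X], IsLogPair p q a b c e d f' g' ∧ (f' ≠ 0 ∨ g' ≠ 0) := by
  have hx : ∃ x : K, x ≠ 0 ∧ ((∃ i, f.coeff i = x) ∨ ∃ i, g.coeff i = x) := by
    rcases hfg with hf | hg
    · exact ⟨f.leadingCoeff, leadingCoeff_ne_zero.2 hf, .inl ⟨_, rfl⟩⟩
    · exact ⟨g.leadingCoeff, leadingCoeff_ne_zero.2 hg, .inr ⟨_, rfl⟩⟩
  obtain ⟨x, hx, hxc⟩ := hx
  obtain ⟨ℓ, hℓ⟩ : ∃ ℓ : Module.Dual L K, ℓ x ≠ 0 := by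
    by_contra! h0
    exact hx ((Module.forall_dual_apply_eq_zero_iff L x).1 h0)
  obtain ⟨Φ, hΦ, hmul⟩ := exists_addMonoidHom_coeff ℓ
  have hlin : ∀ {r : L} {n : ℕ}, (X - C (algebraMap L K r)) ^ n ∣ f - C (algebraMap L K r) * g →
      (X - C r) ^ n ∣ Φ f - C r * Φ g := by
    rintro r n ⟨w, hw⟩
    have h1 := hmul (C r) g
    have h2 := hmul ((X - C r) ^ n) w
    simp only [map_C, Polynomial.map_pow, Polynomial.map_sub, map_X] at h1 h2
    rw [← h1, ← map_sub, hw, h2]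
    exact dvd_mul_right _ _
  refine ⟨Φ f, Φ g, ⟨fun i hi => by rw [hΦ, h.coeff_left i hi, map_zero],
    fun i hi => by rw [hΦ, h.coeff_right i hi, map_zero],
    X_pow_dvd_iff.2 fun i hi => by rw [hΦ, X_pow_dvd_iff.1 h.dvd_zero i hi, map_zero],
    hlin h.dvd_fst, hlin h.dvd_snd⟩, ?_⟩
  rcases hxc with ⟨i, hi⟩ | ⟨i, hi⟩
  · exact .inl fun h0 => hℓ (by rw [← hi, ← hΦ, h0, coeff_zero])
  · exact .inr fun h0 => hℓ (by rw [← hi, ← hΦ, h0, coeff_zero])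

theorem const_mul {R : Type*} [CommRing R] {p q : R} (r : R) {f g : R[X]}
    (h : IsLogPair p q a b c e d f g) : IsLogPair p q a b c e d (C r * f) (C r * g) where
  coeff_left i hi := by simp [h.coeff_left i hi]
  coeff_right i hi := by simp [h.coeff_right i hi]
  dvd_zero := h.dvd_zero.mul_left _
  dvd_fst := by rw [mul_left_comm, ← mul_sub]; exact h.dvd_fst.mul_left _
  dvd_snd := by rw [mul_left_comm, ← mul_sub]; exact h.dvd_snd.mul_left _

theorem exists_integral {A L : Type*} [CommRing A] [IsDomain A] [Field L] [Algebra A L]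
    [IsFractionRing A L] {p q : A} {f g : L[X]}
    (h : IsLogPair (algebraMap A L p) (algebraMap A L q) a b c e d f g) (hfg : f ≠ 0 ∨ g ≠ 0) :
    ∃ f' g' : A[X], IsLogPair p q a b c e d f' g' ∧ (f' ≠ 0 ∨ g' ≠ 0) := by
  have hinj := IsFractionRing.injective A L
  obtain ⟨r, hr, hrf⟩ := IsLocalization.integerNormalization_spec (nonZeroDivisors A) f
  obtain ⟨s, hs, hsg⟩ := IsLocalization.integerNormalization_spec (nonZeroDivisors A) g
  set F := IsLocalization.integerNormalization (nonZeroDivisors A) f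
  set G := IsLocalization.integerNormalization (nonZeroDivisors A) g
  have hrs : algebraMap A L (r * s) ≠ 0 :=
    (map_ne_zero_iff _ hinj).2 (nonZeroDivisors.ne_zero (mul_mem hr hs))
  have hF : (C s * F).map (algebraMap A L) = C (algebraMap A L (r * s)) * f := by
    rw [Polynomial.map_mul, hrf, map_C, ← IsScalarTower.algebraMap_smul L r f, smul_eq_C_mul,
      ← mul_assoc, ← C_mul, map_mul (algebraMap A L), mul_comm (algebraMap A L s)]
  have hG : (C r * G).map (algebraMap A L) = C (algebraMap A L (r * s)) * g := by
    rw [Polynomial.map_mul, hsg, map_C, ← IsScalarTower.algebraMap_smul L s g, smul_eq_C_mul,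
      ← mul_assoc, ← C_mul, map_mul (algebraMap A L)]
  refine ⟨C s * F, C r * G, of_map hinj ?_, ?_⟩
  · rw [hF, hG]; exact h.const_mul _
  · refine hfg.imp (fun hf h0 => hf ?_) (fun hg h0 => hg ?_)
    · rw [h0, Polynomial.map_zero, eq_comm, mul_eq_zero] at hF
      exact hF.resolve_left (C_ne_zero.2 hrs)
    · rw [h0, Polynomial.map_zero, eq_comm, mul_eq_zero] at hG
      exact hG.resolve_left (C_ne_zero.2 hrs)

theorem exists_polynomial_of_transcendental {F K : Type*} [Field F] [Field K] [Algebra F K] {t : K}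
    (ht : Transcendental F t) {f g : K[X]} (h : IsLogPair 1 t a b c e d f g)
    (hfg : f ≠ 0 ∨ g ≠ 0) :
    ∃ f' g' : F[X][X], IsLogPair 1 X a b c e d f' g' ∧ (f' ≠ 0 ∨ g' ≠ 0) := by
  let φ : FractionRing F[X] →+* K :=
    IsFractionRing.lift (g := (aeval t : F[X] →ₐ[F] K).toRingHom)
      (transcendental_iff_injective.1 ht)
  let := φ.toAlgebra
  have hX : algebraMap (FractionRing F[X]) K (algebraMap F[X] (FractionRing F[X]) X) = t := by
    change φ _ = t
    rw [IsFractionRing.lift_algebraMap]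
    exact aeval_X t
  have h1 : IsLogPair (algebraMap (FractionRing F[X]) K (algebraMap F[X] (FractionRing F[X]) 1))
      (algebraMap (FractionRing F[X]) K (algebraMap F[X] (FractionRing F[X]) X))
      a b c e d f g := by rw [hX, map_one, map_one]; exact h
  obtain ⟨f₁, g₁, h2, hfg₁⟩ := h1.exists_descent hfg
  exact h2.exists_integral hfg₁

end IsLogPair

end Descent

/-! ### Reduction of the vanishing statement to sorted multiplicities. -/

/-- The three transpositions generate all permutations of the four lines, so the last multiplicity
can be made smallest and the first largest. -/
theorem false_of_symmetric {P : ℕ → ℕ → ℕ → ℕ → Prop}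
    (h12 : ∀ {a b c e}, P a b c e → P b a c e) (h13 : ∀ {a b c e}, P a b c e → P c b a e)
    (h34 : ∀ {a b c e}, P a b c e → P a b e c)
    (h : ∀ {a b c e}, e ≤ b → e ≤ c → b ≤ a → c ≤ a → ¬ P a b c e) (a b c e : ℕ) :
    ¬ P a b c e := by
  have key : ∀ {a b c e}, e ≤ a → e ≤ b → e ≤ c → ¬ P a b c e := by
    intro a b c e ha hb hc hP
    by_cases h1 : b ≤ a
    · by_cases h2 : c ≤ a
      · exact h hb hc h1 h2 hP
      · exact h hb ha (by omega) (by omega) (h13 hP)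
    · by_cases h2 : c ≤ b
      · exact h ha hc (by omega) h2 (h12 hP)
      · exact h hb ha (by omega) (by omega) (h13 hP)
  intro hP
  by_cases h1 : e ≤ a ∧ e ≤ b ∧ e ≤ c
  · exact key h1.1 h1.2.1 h1.2.2 hP
  by_cases h2 : c ≤ a ∧ c ≤ b ∧ c ≤ e
  · exact key h2.1 h2.2.1 h2.2.2 (h34 hP)
  by_cases h3 : a ≤ b ∧ a ≤ c ∧ a ≤ e
  · exact key (by omega) (by omega) (by omega) (h34 (h13 hP))
  · exact key (by omega) (by omega) (by omega) (h34 (h13 (h12 hP)))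

theorem IsLogPair.eq_zero_of_transcendental {F : Type} {K : Type*} [Field F] [CharZero F] [Field K]
    [Algebra F K] {p q : K} (hp : p ≠ 0) (ht : Transcendental F (q / p))
    {a b c e d : ℕ} {f g : K[X]} (h : IsLogPair p q a b c e d f g)
    (ha : 0 < a) (hb : 0 < b) (hc : 0 < c) (he : 0 < e)
    (ha' : 2 * a < a + b + c + e) (hb' : 2 * b < a + b + c + e) (hc' : 2 * c < a + b + c + e)
    (he' : 2 * e < a + b + c + e) (hne : ¬ (a = 1 ∧ b = 1 ∧ c = 1 ∧ e = 1))
    (hd : 2 * d + 2 ≤ a + b + c + e) : f = 0 ∧ g = 0 := by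
  have : CharZero K := charZero_of_injective_algebraMap (algebraMap F K).injective
  have halg : ∀ r : F, IsAlgebraic F (algebraMap F K r) := fun r => isAlgebraic_algebraMap r
  have hq : q ≠ 0 := by
    rintro rfl
    rw [zero_div, ← map_zero (algebraMap F K)] at ht
    exact ht (halg 0)
  have hpq : p ≠ q := by
    rintro rfl
    rw [div_self hp, ← map_one (algebraMap F K)] at ht
    exact ht (halg 1)
  by_contra hfg
  have hfg := not_and_or.1 hfg
  have hw := h.wronskian_ne_zero hp hq hpq hfg (by omega) (by omega) (by omega) (by omega)
  have hle := h.sum_le hp hq hpq hw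
  -- The points p, q vary with the order of the lines. The cross-ratio q/p changes by r ↦ 1/r or r ↦
  -- 1 - r, which preserves transcendence; d is fixed.
  refine false_of_symmetric (P := fun a b c e => (a + b + c + e = 2 * d + 2 ∧ 0 < a ∧ 0 < b ∧
    0 < c ∧ 0 < e ∧ a ≤ d ∧ b ≤ d ∧ c ≤ d ∧ e ≤ d) ∧ ∃ (p q : K) (f g : K[X]), p ≠ 0 ∧ q ≠ 0 ∧
    Transcendental F (q / p) ∧ IsLogPair p q a b c e d f g ∧ (f ≠ 0 ∨ g ≠ 0)) ?_ ?_ ?_ ?_ a b c e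
    ⟨by omega, p, q, f, g, hp, hq, ht, h, hfg⟩
  · rintro a b c e ⟨hn, p, q, f, g, hp, hq, ht, h, hfg⟩
    refine ⟨by omega, p⁻¹, q⁻¹, _, _, inv_ne_zero hp, inv_ne_zero hq, ?_, h.reflect_swap hp hq, ?_⟩
    · rw [inv_div_inv, ← inv_div, Transcendental, IsAlgebraic.inv_iff]
      exact ht
    · rw [Ne, Ne, reflect_eq_zero_iff, reflect_eq_zero_iff]; exact hfg.symm
  · rintro a b c e ⟨hn, p, q, f, g, hp, hq, ht, h, hfg⟩
    refine ⟨by omega, p, p - q, _, _, hp, ?_, ?_, h.comp_swap (by omega), ?_⟩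
    · rintro h0
      rw [← sub_eq_zero.1 h0, div_self hp, ← map_one (algebraMap F K)] at ht
      exact ht (halg 1)
    · intro h0
      refine ht ?_
      have := (halg 1).sub h0
      rwa [map_one, sub_div, div_self hp, sub_sub_cancel] at this
    · have hcomp : ∀ s : K[X], s.comp (C p - X) = 0 → s = 0 := by
        intro s hs
        have h1 : (s.comp (C p - X)).comp (C p - X) = s := by
          rw [comp_assoc]; simp
        rw [← h1, hs, zero_comp]
      by_contra! h0
      have h2 := hcomp _ h0.2
      have h1 := hcomp _ h0.1
      subst h2
      rw [mul_zero, zero_sub, neg_eq_zero] at h1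
      simp [h1] at hfg
  · rintro a b c e ⟨hn, p, q, f, g, hp, hq, ht, h, hfg⟩
    refine ⟨by omega, q, p, f, g, hq, hp, ?_, h.swap_points, hfg⟩
    rwa [← inv_div, Transcendental, IsAlgebraic.inv_iff]
  · rintro a b c e h1 h2 h3 h4 ⟨hn, p, q, f, g, hp, hq, ht, h, hfg⟩
    obtain ⟨f', g', h', hfg'⟩ := (h.scale hp).exists_polynomial_of_transcendental ht (by
      have hcomp : ∀ s : K[X], s.comp (C p * X) = 0 → s = 0 := by
        intro s hs
        have h1 : (s.comp (C p * X)).comp (C p⁻¹ * X) = s := by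
          rw [comp_assoc]
          simp only [mul_comp, C_comp, X_comp]
          rw [← mul_assoc, ← C_mul, mul_inv_cancel₀ hp, C_1, one_mul, comp_X]
        rw [← h1, hs, zero_comp]
      exact hfg.imp (fun hf => mul_ne_zero (by simpa using hp) (mt (hcomp f) hf))
        (fun hg => mt (hcomp g) hg))
    -- The bound 2 ≤ a holds because a = 1 would make the total 4, and then the original
    -- multiplicities would all be 1, against `hne`.
    have h0 := h'.eq_zero_polynomial (by omega) (by omega) h1 h2 h3 h4 (by omega) (by omega)
    simp [h0] at hfg'

/-! ### Existence of logarithmic pairs in the middle degrees. -/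

namespace IsLogPair

variable {K : Type*} [Field K] {p q : K} {a b c e d : ℕ}

theorem finrank_degreeLT (n : ℕ) : Module.finrank K (degreeLT K n) = n := by
  rw [(degreeLTEquiv K n).finrank_eq, Module.finrank_fin_fun]

instance finite_degreeLT (n : ℕ) : Module.Finite K (degreeLT K n) :=
  Module.Finite.equiv (degreeLTEquiv K n).symm

/-- The remainder of `X ^ a * u - r * v` modulo `(X - r) ^ c`, as a function of `(u, v)`. -/
noncomputable def remainderMap (r : K) (a c : ℕ) : K[X] × K[X] →ₗ[K] degreeLT K c :=
  LinearMap.codRestrict (degreeLT K c)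
    ((modByMonicHom ((X - C r) ^ c)).comp
      ((LinearMap.mulLeft K (X ^ a)).comp (LinearMap.fst K K[X] K[X])
        - (LinearMap.mulLeft K (C r)).comp (LinearMap.snd K K[X] K[X])))
    (fun x => by
      rw [mem_degreeLT]
      refine (degree_modByMonic_lt _ ((monic_X_sub_C r).pow c)).trans_le ?_
      rw [degree_pow, degree_X_sub_C]; simp)

theorem remainderMap_eq_zero_iff (r : K) (a c : ℕ) (u v : K[X]) :
    remainderMap r a c (u, v) = 0 ↔ (X - C r) ^ c ∣ X ^ a * u - C r * v := by
  rw [← modByMonic_eq_zero_iff_dvd ((monic_X_sub_C r).pow c), Subtype.ext_iff]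
  rfl

/-- A dimension count: the conditions at x = 0 and y = 0 leave 2(d+1) - a - b coefficients, and the
two remainders impose at most c + e equations. -/
theorem exists_notMem (p q : K) (ha : a ≤ d + 1) (hb : b ≤ d + 1)
    (N : Submodule K (K[X] × K[X])) [Module.Finite K N]
    (hN : Module.finrank K N + (a + b + c + e) < 2 * (d + 1)) :
    ∃ f g, IsLogPair p q a b c e d f g ∧ (f, g) ∉ N := by
  by_contra! hall
  let ι : degreeLT K (d + 1 - a) × degreeLT K (d + 1 - b) →ₗ[K] K[X] × K[X] :=
    (degreeLT K (d + 1 - a)).subtype.prodMap (degreeLT K (d + 1 - b)).subtype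
  let Ψ := ((remainderMap p a c).prod (remainderMap q a e)).comp ι
  let J : K[X] × K[X] →ₗ[K] K[X] × K[X] :=
    (LinearMap.mulLeft K (X ^ a)).prodMap LinearMap.id
  have hJ : ∀ x : LinearMap.ker Ψ, (J.comp ι) x.1 ∈ N := by
    rintro ⟨⟨⟨u, hu⟩, ⟨v, hv⟩⟩, hx⟩
    rw [mem_degreeLT] at hu hv
    have hx' : (remainderMap p a c (u, v), remainderMap q a e (u, v)) = 0 := hx
    rw [Prod.mk_eq_zero, remainderMap_eq_zero_iff, remainderMap_eq_zero_iff] at hx'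
    refine hall (X ^ a * u) v ⟨fun i hi => ?_, fun i hi => ?_, dvd_mul_right _ _, hx'.1, hx'.2⟩
    · rw [coeff_X_pow_mul', coeff_eq_zero_of_degree_lt, ite_self]
      exact hu.trans_le (by exact_mod_cast (by omega))
    · exact coeff_eq_zero_of_degree_lt (hv.trans_le (by exact_mod_cast (by omega)))
  have hJi : Function.Injective J := Function.Injective.prodMap
    (fun u v h => mul_left_cancel₀ (pow_ne_zero a X_ne_zero) h) Function.injective_id
  have hι : Function.Injective ι :=
    Function.Injective.prodMap Subtype.val_injective Subtype.val_injective
  have h1 := LinearMap.finrank_le_finrank_of_injective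
    (f := ((J.comp ι).comp (LinearMap.ker Ψ).subtype).codRestrict N hJ)
    fun x y h => Subtype.ext (hι (hJi (congrArg Subtype.val h)))
  have h2 := LinearMap.finrank_range_add_finrank_ker Ψ
  have h3 := Submodule.finrank_le (LinearMap.range Ψ)
  rw [Module.finrank_prod, finrank_degreeLT, finrank_degreeLT] at h2 h3
  omega

/-- Both pairs are multiples w(u, v) and z(u, v) of one coprime pair. By Bézout gcd(w, z)(u, v) is
again logarithmic, and minimality of `k` leaves no room for w to be larger than the gcd. -/
theorem exists_eq_mul_of_det_eq_zero {k k' : ℕ} (hk : 0 < k) {f₁ g₁ f₂ g₂ : K[X]}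
    (h₁ : IsLogPair p q a b c e k f₁ g₁) (h₂ : IsLogPair p q a b c e k' f₂ g₂)
    (hne : f₁ ≠ 0 ∨ g₁ ≠ 0)
    (hmin : ∀ j < k, ∀ f g, IsLogPair p q a b c e j f g → f = 0 ∧ g = 0)
    (hdet : f₁ * g₂ = f₂ * g₁) :
    ∃ r : K[X], f₂ = r * f₁ ∧ g₂ = r * g₁ ∧ (r ≠ 0 → r.natDegree + k ≤ k') := by
  classical
  suffices hr : ∃ r : K[X], f₂ = r * f₁ ∧ g₂ = r * g₁ by
    obtain ⟨r, rfl, rfl⟩ := hr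
    refine ⟨r, rfl, rfl, fun hr => ?_⟩
    by_contra! hlt
    have := hmin (k - 1) (by omega) f₁ g₁ ⟨fun i hi => ?_, fun i hi => ?_, h₁.dvd_zero,
      h₁.dvd_fst, h₁.dvd_snd⟩
    · simp [this] at hne
    · by_contra h0
      have hf : f₁ ≠ 0 := by rintro rfl; simp at h0
      have h3 := le_natDegree_of_ne_zero h0
      have h4 := h₂.natDegree_left_le
      rw [natDegree_mul hr hf] at h4
      omega
    · by_contra h0
      have hf : g₁ ≠ 0 := by rintro rfl; simp at h0
      have h3 := le_natDegree_of_ne_zero h0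
      have h4 := h₂.natDegree_right_add_le (mul_ne_zero hr hf)
      rw [natDegree_mul hr hf] at h4
      omega
  have hc : EuclideanDomain.gcd f₁ g₁ ≠ 0 := by
    rw [Ne, EuclideanDomain.gcd_eq_zero_iff]; tauto
  obtain ⟨u, hu⟩ := EuclideanDomain.gcd_dvd_left f₁ g₁
  obtain ⟨v, hv⟩ := EuclideanDomain.gcd_dvd_right f₁ g₁
  have hgcd := EuclideanDomain.gcd_eq_gcd_ab f₁ g₁
  generalize EuclideanDomain.gcdA f₁ g₁ = s at hgcd
  generalize EuclideanDomain.gcdB f₁ g₁ = t at hgcd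
  generalize EuclideanDomain.gcd f₁ g₁ = w at *
  subst hu hv
  have hst : u * s + v * t = 1 := mul_left_cancel₀ hc (by linear_combination -hgcd)
  have hdet' : u * g₂ = f₂ * v := mul_left_cancel₀ hc (by linear_combination hdet)
  obtain ⟨z, rfl, rfl⟩ : ∃ z, f₂ = z * u ∧ g₂ = z * v :=
    ⟨s * f₂ + t * g₂, by linear_combination -f₂ * hst - t * hdet',
      by linear_combination -g₂ * hst + s * hdet'⟩
  obtain ⟨w', hw'⟩ := EuclideanDomain.gcd_dvd_left w z
  obtain ⟨z', hz'⟩ := EuclideanDomain.gcd_dvd_right w z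
  have hG := EuclideanDomain.gcd_eq_gcd_ab w z
  generalize EuclideanDomain.gcdA w z = s' at hG
  generalize EuclideanDomain.gcdB w z = t' at hG
  generalize EuclideanDomain.gcd w z = y at *
  have hy : y ≠ 0 := by rintro rfl; simp [hw'] at hc
  have hw0 : w' ≠ 0 := by rintro rfl; simp [hw'] at hc
  have hdeg : ∀ x : K[X], x ≠ 0 → (w * x).natDegree = w'.natDegree + (y * x).natDegree := by
    intro x hx
    rw [hw', mul_right_comm, natDegree_mul (mul_ne_zero hy hx) hw0, add_comm]
  have hle : w'.natDegree ≤ k := by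
    rcases hne with h | h
    · have h3 := h₁.natDegree_left_le
      rw [hdeg u (right_ne_zero_of_mul h)] at h3
      omega
    · have h3 := h₁.natDegree_right_le
      rw [hdeg v (right_ne_zero_of_mul h)] at h3
      omega
  have hlin : ∀ r : K, y * u - C r * (y * v) =
      (w * u - C r * (w * v)) * s' + (z * u - C r * (z * v)) * t' := fun r => by
    rw [hG]; ring
  have hpair : IsLogPair p q a b c e (k - w'.natDegree) (y * u) (y * v) := by
    refine ⟨fun i hi => ?_, fun i hi => ?_, ?_, ?_, ?_⟩
    · by_contra h0
      have hu0 : u ≠ 0 := by rintro rfl; simp at h0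
      have h3 := le_natDegree_of_ne_zero h0
      have h4 := h₁.natDegree_left_le
      rw [hdeg u hu0] at h4
      omega
    · by_contra h0
      have hv0 : v ≠ 0 := by rintro rfl; simp at h0
      have h3 := le_natDegree_of_ne_zero h0
      have h4 := h₁.natDegree_right_add_le (mul_ne_zero hc hv0)
      rw [hdeg v hv0] at h4
      omega
    · have : y * u = (w * u) * s' + (z * u) * t' := by rw [hG]; ring
      rw [this]
      exact dvd_add (h₁.dvd_zero.mul_right _) (h₂.dvd_zero.mul_right _)
    · rw [hlin]; exact dvd_add (h₁.dvd_fst.mul_right _) (h₂.dvd_fst.mul_right _)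
    · rw [hlin]; exact dvd_add (h₁.dvd_snd.mul_right _) (h₂.dvd_snd.mul_right _)
  have hw'0 : w'.natDegree = 0 := by
    by_contra h0
    have h3 := hmin _ (by omega) _ _ hpair
    rw [mul_eq_zero, mul_eq_zero] at h3
    simp [h3.1.resolve_left hy, h3.2.resolve_left hy] at hne
  rw [eq_C_of_natDegree_eq_zero hw'0] at hw' hw0
  generalize w'.coeff 0 = l at *
  have hl : C l⁻¹ * C l = 1 := by rw [← C_mul, inv_mul_cancel₀ (by simpa using hw0), C_1]
  refine ⟨C l⁻¹ * z', ?_, ?_⟩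
  · rw [hz', hw']; linear_combination -(y * u * z') * hl
  · rw [hz', hw']; linear_combination -(y * v * z') * hl

/-- If there are no logarithmic pairs below half of the total multiplicity, there are two pairs
in the middle degrees whose determinant does not vanish. -/
theorem exists_det_ne_zero {k k' : ℕ} (hk : 0 < k) (hkk : k ≤ k') (hsum : a + b + c + e = k + k')
    (hk1 : k' ≤ k + 1) (ha : a ≤ k + 1) (hb : b ≤ k + 1)
    (hmin : ∀ j < k, ∀ f g, IsLogPair p q a b c e j f g → f = 0 ∧ g = 0) :
    ∃ f₁ g₁ f₂ g₂, IsLogPair p q a b c e k f₁ g₁ ∧ IsLogPair p q a b c e k' f₂ g₂ ∧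
      f₁ * g₂ - f₂ * g₁ ≠ 0 := by
  obtain ⟨f₁, g₁, h₁, hne⟩ := exists_notMem (c := c) (e := e) p q ha hb ⊥ (by simp; omega)
  rw [Submodule.mem_bot, Prod.mk_eq_zero, not_and_or] at hne
  -- The multiples of the first pair by polynomials of degree at most k' - k have dimension at most
  -- k' - k + 1, one less than the count 2(k' + 1) - (k + k'), so some pair of degree k' is not
  -- among them.
  let N : degreeLT K (k' - k + 1) →ₗ[K] K[X] × K[X] :=
    (((LinearMap.mulRight K f₁).prod (LinearMap.mulRight K g₁))).comp
      (degreeLT K (k' - k + 1)).subtype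
  obtain ⟨f₂, g₂, h₂, hnot⟩ := exists_notMem (c := c) (e := e) p q
    (show a ≤ k' + 1 by omega) (show b ≤ k' + 1 by omega) (LinearMap.range N) (by
      have := LinearMap.finrank_range_le N
      rw [finrank_degreeLT] at this
      omega)
  refine ⟨f₁, g₁, f₂, g₂, h₁, h₂, fun hdet => hnot ?_⟩
  obtain ⟨r, hr1, hr2, hr⟩ := exists_eq_mul_of_det_eq_zero hk h₁ h₂ hne hmin (sub_eq_zero.1 hdet)
  refine ⟨⟨r, ?_⟩, by rw [hr1, hr2]; rfl⟩
  rw [mem_degreeLT]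
  by_cases h0 : r = 0
  · rw [h0, degree_zero]; exact WithBot.bot_lt_coe _
  · rw [degree_eq_natDegree h0]
    have := hr h0
    exact_mod_cast (by omega)

end IsLogPair

end

/-! ### Passage between binary forms and polynomials in one variable. -/

section Homogenize

open MvPolynomial

variable {K : Type*} [Field K]

/-- The homogeneous form of degree `D` in `x`, `y` with dehomogenization `f`, provided that
`f` has degree at most `D`. -/
noncomputable def homogenize (D : ℕ) : Polynomial K →ₗ[K] MvPolynomial (Fin 2) K where
  toFun f := ∑ i ∈ Finset.range (D + 1), C (f.coeff i) * (X 0 ^ i * X 1 ^ (D - i))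
  map_add' f g := by
    simp only [Polynomial.coeff_add, C_add, add_mul, Finset.sum_add_distrib]
  map_smul' r f := by
    simp only [Polynomial.coeff_smul, smul_eq_mul, C_mul, MvPolynomial.smul_eq_C_mul,
      Finset.mul_sum, mul_assoc, RingHom.id_apply]

/-- Substitution of `(z, 1)` for `(x, y)`. -/
noncomputable def dehomogenize : MvPolynomial (Fin 2) K →ₐ[K] Polynomial K :=
  aeval ![Polynomial.X, 1]

theorem homogenize_apply (D : ℕ) (f : Polynomial K) :
    homogenize D f = ∑ i ∈ Finset.range (D + 1), C (f.coeff i) * (X 0 ^ i * X 1 ^ (D - i)) := rfl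

@[simp] theorem dehomogenize_X_zero :
    dehomogenize (X 0 : MvPolynomial (Fin 2) K) = Polynomial.X := by simp [dehomogenize]

@[simp] theorem dehomogenize_X_one :
    dehomogenize (X 1 : MvPolynomial (Fin 2) K) = 1 := by simp [dehomogenize]

@[simp] theorem dehomogenize_C (r : K) :
    dehomogenize (C r : MvPolynomial (Fin 2) K) = Polynomial.C r := by simp [dehomogenize]

theorem isHomogeneous_homogenize (D : ℕ) (f : Polynomial K) :
    (homogenize D f).IsHomogeneous D := by
  refine IsHomogeneous.sum _ _ _ fun i hi => ?_
  have h := (isHomogeneous_C (Fin 2) (f.coeff i)).mul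
    (((isHomogeneous_X K (0 : Fin 2)).pow i).mul ((isHomogeneous_X K (1 : Fin 2)).pow (D - i)))
  rw [Finset.mem_range] at hi
  convert h using 1
  omega

theorem dehomogenize_homogenize_eq_sum (D : ℕ) (f : Polynomial K) :
    dehomogenize (homogenize D f) =
      ∑ i ∈ Finset.range (D + 1), Polynomial.C (f.coeff i) * Polynomial.X ^ i := by
  simp [homogenize_apply]

theorem dehomogenize_homogenize {D : ℕ} {f : Polynomial K} (hf : f.natDegree ≤ D) :
    dehomogenize (homogenize D f) = f := by
  rw [dehomogenize_homogenize_eq_sum, ← f.as_sum_range_C_mul_X_pow' (by omega)]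

theorem natDegree_dehomogenize_homogenize_le (D : ℕ) (f : Polynomial K) :
    (dehomogenize (homogenize D f)).natDegree ≤ D := by
  rw [dehomogenize_homogenize_eq_sum]
  refine Polynomial.natDegree_sum_le_of_forall_le _ _ fun i hi => ?_
  have := Polynomial.natDegree_C_mul_X_pow_le (f.coeff i) i
  rw [Finset.mem_range] at hi
  omega

theorem homogenize_dehomogenize {D : ℕ} {F : MvPolynomial (Fin 2) K} (hF : F.IsHomogeneous D) :
    homogenize D (dehomogenize F) = F := by
  conv_rhs => rw [F.as_sum]
  rw [F.as_sum, map_sum, map_sum, ← F.as_sum]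
  refine Finset.sum_congr rfl fun s hs => ?_
  have hdeg : s 0 + s 1 = D := by
    have := hF (mem_support_iff.1 hs)
    rw [Finsupp.weight_apply, Finsupp.sum_fintype _ _ (by simp)] at this
    simpa using this
  have hmon : monomial s (coeff s F) = C (coeff s F) * (X 0 ^ s 0 * X 1 ^ s 1) := by
    rw [monomial_eq, Finsupp.prod_fintype _ _ (by simp), Fin.prod_univ_two]
  rw [hmon]
  simp only [map_mul, map_pow, dehomogenize_C, dehomogenize_X_zero, dehomogenize_X_one, one_pow,
    mul_one]
  rw [homogenize_apply, Finset.sum_eq_single (s 0)]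
  · simp [← hdeg]
  · intro i _ hi
    simp [Polynomial.coeff_X_pow, hi]
  · intro h
    rw [Finset.mem_range] at h
    omega

theorem natDegree_dehomogenize_le {D : ℕ} {F : MvPolynomial (Fin 2) K} (hF : F.IsHomogeneous D) :
    (dehomogenize F).natDegree ≤ D := by
  rw [← homogenize_dehomogenize hF]
  exact natDegree_dehomogenize_homogenize_le _ _

theorem eq_of_dehomogenize_eq {D : ℕ} {F G : MvPolynomial (Fin 2) K} (hF : F.IsHomogeneous D)
    (hG : G.IsHomogeneous D) (h : dehomogenize F = dehomogenize G) : F = G := by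
  rw [← homogenize_dehomogenize hF, h, homogenize_dehomogenize hG]

/-- Setting y = 1 hides powers of y, so divisibility lifts only with the degree control on the
cofactor supplied by `hdeg`. -/
theorem dvd_homogenize {m D : ℕ} {P : MvPolynomial (Fin 2) K} (hP : P.IsHomogeneous m)
    {f : Polynomial K} (hdeg : ∀ u : Polynomial K, f = dehomogenize P * u → u ≠ 0 →
      m ≤ D ∧ u.natDegree ≤ D - m) (hf : f.natDegree ≤ D)
    (hdvd : dehomogenize P ∣ f) : P ∣ homogenize D f := by
  obtain ⟨u, rfl⟩ := hdvd
  by_cases hu : u = 0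
  · simp [hu]
  obtain ⟨hm, hud⟩ := hdeg u rfl hu
  refine ⟨homogenize (D - m) u, ?_⟩
  have h1 := hP.mul (isHomogeneous_homogenize (D - m) u)
  rw [Nat.add_sub_cancel' hm] at h1
  refine eq_of_dehomogenize_eq (isHomogeneous_homogenize _ _) h1 ?_
  rw [dehomogenize_homogenize hf, map_mul, dehomogenize_homogenize hud]

theorem X_sub_isHomogeneous (p : K) :
    (X 0 - C p * X 1 : MvPolynomial (Fin 2) K).IsHomogeneous 1 := by
  have h := (isHomogeneous_C (Fin 2) p).mul (isHomogeneous_X K (1 : Fin 2))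
  rw [zero_add] at h
  exact (isHomogeneous_X K (0 : Fin 2)).sub h

theorem X_sub_pow_isHomogeneous (p : K) (m : ℕ) :
    ((X 0 - C p * X 1 : MvPolynomial (Fin 2) K) ^ m).IsHomogeneous m := by
  simpa using (X_sub_isHomogeneous p).pow m

theorem X_sub_pow_dvd_homogenize {p : K} {m D : ℕ} {f : Polynomial K} (hf : f.natDegree ≤ D)
    (h : (Polynomial.X - Polynomial.C p) ^ m ∣ f) :
    (X 0 - C p * X 1) ^ m ∣ homogenize D f := by
  have hde : dehomogenize ((X 0 - C p * X 1 : MvPolynomial (Fin 2) K) ^ m)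
      = (Polynomial.X - Polynomial.C p) ^ m := by simp
  refine dvd_homogenize (X_sub_pow_isHomogeneous p m) (fun u hu hu0 => ?_) hf (by rwa [hde])
  rw [hde] at hu
  rw [hu, ((Polynomial.monic_X_sub_C p).pow m).natDegree_mul' hu0, Polynomial.natDegree_pow,
    Polynomial.natDegree_X_sub_C] at hf
  omega

theorem X_one_pow_dvd_homogenize {m D : ℕ} {f : Polynomial K}
    (hf : ∀ i, D < i + m → f.coeff i = 0) : X 1 ^ m ∣ homogenize D f := by
  have hle : f.natDegree ≤ D := Polynomial.natDegree_le_iff_coeff_eq_zero.2 fun i hi =>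
    hf i (by omega)
  refine dvd_homogenize (by simpa using (isHomogeneous_X K (1 : Fin 2)).pow m)
    (fun u hu hu0 => ?_) hle (by simp)
  rw [map_pow, dehomogenize_X_one, one_pow, one_mul] at hu
  subst hu
  have : ¬ D < f.natDegree + m := fun h => hu0 (Polynomial.leadingCoeff_eq_zero.1 (hf _ h))
  omega

theorem coeff_dehomogenize_eq_zero {m D : ℕ} {G : MvPolynomial (Fin 2) K} (hG : G.IsHomogeneous D)
    (h : X 1 ^ m ∣ G) {i : ℕ} (hi : D < i + m) : (dehomogenize G).coeff i = 0 := by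
  rcases lt_or_ge D i with hDi | hDi
  · exact Polynomial.coeff_eq_zero_of_natDegree_lt ((natDegree_dehomogenize_le hG).trans_lt hDi)
  -- The chart x = 1, where the order along y = 0 is visible; its coefficient D - i is the
  -- coefficient i in the chart y = 1.
  let ψ : MvPolynomial (Fin 2) K →ₐ[K] Polynomial K := aeval ![1, Polynomial.X]
  have h1 : Polynomial.X ^ m ∣ ψ G := by simpa [ψ] using map_dvd ψ h
  rw [← homogenize_dehomogenize hG, homogenize_apply] at h1
  have h2 := Polynomial.X_pow_dvd_iff.1 h1 (D - i) (by omega)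
  simp only [map_sum, map_mul, map_pow, ψ, aeval_X, algHom_C, Matrix.cons_val_zero,
    Matrix.cons_val_one, one_pow, one_mul, Polynomial.algebraMap_eq, Polynomial.finsetSum_coeff,
    Polynomial.coeff_C_mul_X_pow] at h2
  rw [Finset.sum_eq_single i] at h2
  · simpa using h2
  · intro j hj hji
    rw [Finset.mem_range] at hj
    rw [if_neg (by omega)]
  · intro h
    rw [Finset.mem_range] at h
    omega

/-- Pairs of homogeneous forms that are the coefficients of a logarithmic derivation. -/
structure IsLogForms (p q : K) (a b c e : ℕ) (F G : MvPolynomial (Fin 2) K) : Prop where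
  dvd_zero : X 0 ^ a ∣ F
  dvd_one : X 1 ^ b ∣ G
  dvd_fst : (X 0 - C p * X 1) ^ c ∣ F - C p * G
  dvd_snd : (X 0 - C q * X 1) ^ e ∣ F - C q * G

variable {p q : K} {a b c e D : ℕ}

theorem IsLogForms.isLogPair {F G : MvPolynomial (Fin 2) K} (h : IsLogForms p q a b c e F G)
    (hF : F.IsHomogeneous D) (hG : G.IsHomogeneous D) :
    IsLogPair p q a b c e D (dehomogenize F) (dehomogenize G) where
  coeff_left := Polynomial.natDegree_le_iff_coeff_eq_zero.1 (natDegree_dehomogenize_le hF)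
  coeff_right _ hi := coeff_dehomogenize_eq_zero hG h.dvd_one hi
  dvd_zero := by simpa using map_dvd dehomogenize h.dvd_zero
  dvd_fst := by simpa using map_dvd dehomogenize h.dvd_fst
  dvd_snd := by simpa using map_dvd dehomogenize h.dvd_snd

theorem IsLogPair.isLogForms {f g : Polynomial K} (h : IsLogPair p q a b c e D f g) :
    IsLogForms p q a b c e (homogenize D f) (homogenize D g) := by
  have hlin : ∀ r : K, homogenize D f - C r * homogenize D g
      = homogenize D (f - Polynomial.C r * g) := fun r => by
    rw [map_sub, ← Polynomial.smul_eq_C_mul, map_smul, MvPolynomial.smul_eq_C_mul]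
  refine ⟨?_, X_one_pow_dvd_homogenize h.coeff_right, ?_, ?_⟩
  · have h0 : (Polynomial.X - Polynomial.C 0) ^ a ∣ f := by simpa using h.dvd_zero
    simpa using X_sub_pow_dvd_homogenize h.natDegree_left_le h0
  · rw [hlin]
    exact X_sub_pow_dvd_homogenize (h.natDegree_sub_C_mul_le p) h.dvd_fst
  · rw [hlin]
    exact X_sub_pow_dvd_homogenize (h.natDegree_sub_C_mul_le q) h.dvd_snd

/-- The defining polynomial of the multiarrangement. -/
noncomputable def definingPoly (p q : K) (a b c e : ℕ) : MvPolynomial (Fin 2) K :=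
  X 0 ^ a * X 1 ^ b * (X 0 - C p * X 1) ^ c * (X 0 - C q * X 1) ^ e

theorem isHomogeneous_definingPoly (p q : K) (a b c e : ℕ) :
    (definingPoly p q a b c e).IsHomogeneous (a + b + c + e) := by
  have h0 : (X 0 ^ a : MvPolynomial (Fin 2) K).IsHomogeneous a := by
    simpa using (isHomogeneous_X K (0 : Fin 2)).pow a
  have h1 : (X 1 ^ b : MvPolynomial (Fin 2) K).IsHomogeneous b := by
    simpa using (isHomogeneous_X K (1 : Fin 2)).pow b
  exact ((h0.mul h1).mul (X_sub_pow_isHomogeneous p c)).mul (X_sub_pow_isHomogeneous q e)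

theorem isUnit_of_dvd_X_of_dvd_X {r : MvPolynomial (Fin 2) K} (h0 : r ∣ X 0) (h1 : r ∣ X 1) :
    IsUnit r := by
  rcases (X_prime : Prime (X 0 : MvPolynomial (Fin 2) K)).irreducible.dvd_iff.1 h0 with h | h
  · exact h
  · have h2 := h.dvd.trans h1
    rw [X_dvd_X] at h2
    simp at h2

/-- A common divisor divides both x and y. Distinct lines meet at the origin, so their forms are
relatively prime without being comaximal. -/
theorem isRelPrime_of_span {ℓ₁ ℓ₂ : MvPolynomial (Fin 2) K}
    (h0 : ∃ s t, X 0 = s * ℓ₁ + t * ℓ₂) (h1 : ∃ s t, X 1 = s * ℓ₁ + t * ℓ₂) :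
    IsRelPrime ℓ₁ ℓ₂ := by
  obtain ⟨s, t, h0⟩ := h0
  obtain ⟨s', t', h1⟩ := h1
  exact fun r hr1 hr2 => isUnit_of_dvd_X_of_dvd_X
    (h0 ▸ dvd_add (hr1.mul_left s) (hr2.mul_left t))
    (h1 ▸ dvd_add (hr1.mul_left s') (hr2.mul_left t'))

theorem isRelPrime_X_sub {p q : K} (hpq : p ≠ q) :
    IsRelPrime (X 0 - C p * X 1 : MvPolynomial (Fin 2) K) (X 0 - C q * X 1) := by
  have h : C (q - p)⁻¹ * (C q - C p) = (1 : MvPolynomial (Fin 2) K) := by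
    rw [← C_sub, ← C_mul, inv_mul_cancel₀ (sub_ne_zero.2 hpq.symm), C_1]
  refine isRelPrime_of_span ⟨C (q - p)⁻¹ * C q, -C (q - p)⁻¹ * C p, ?_⟩
    ⟨C (q - p)⁻¹, -C (q - p)⁻¹, ?_⟩
  · linear_combination -X 0 * h
  · linear_combination -X 1 * h

theorem isRelPrime_X_one (p : K) :
    IsRelPrime (X 1 : MvPolynomial (Fin 2) K) (X 0 - C p * X 1) :=
  isRelPrime_of_span ⟨C p, 1, by ring⟩ ⟨1, 0, by ring⟩

theorem definingPoly_dvd (hp : p ≠ 0) (hq : q ≠ 0) (hpq : p ≠ q) {P : MvPolynomial (Fin 2) K}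
    (h0 : X 0 ^ a ∣ P) (h1 : X 1 ^ b ∣ P) (h2 : (X 0 - C p * X 1) ^ c ∣ P)
    (h3 : (X 0 - C q * X 1) ^ e ∣ P) : definingPoly p q a b c e ∣ P := by
  have e0 : (X 0 : MvPolynomial (Fin 2) K) = X 0 - C 0 * X 1 := by simp
  have r01 : IsRelPrime (X 0 : MvPolynomial (Fin 2) K) (X 1) := by
    rw [e0]; exact (isRelPrime_X_one 0).symm
  have r0 : ∀ r : K, r ≠ 0 → IsRelPrime (X 0 : MvPolynomial (Fin 2) K) (X 0 - C r * X 1) := by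
    intro r hr
    conv_lhs => rw [e0]
    exact isRelPrime_X_sub hr.symm
  have m1 := (r01.pow (m := a) (n := b)).mul_dvd h0 h1
  have m2 := (((r0 p hp).pow (m := a) (n := c)).mul_left
    ((isRelPrime_X_one p).pow (m := b) (n := c))).mul_dvd m1 h2
  exact ((((r0 q hq).pow (m := a) (n := e)).mul_left
    ((isRelPrime_X_one q).pow (m := b) (n := e))).mul_left
    ((isRelPrime_X_sub hpq).pow (m := c) (n := e))).mul_dvd m2 h3

theorem IsLogForms.definingPoly_dvd_det (hp : p ≠ 0) (hq : q ≠ 0) (hpq : p ≠ q)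
    {F G F' G' : MvPolynomial (Fin 2) K} (h : IsLogForms p q a b c e F G)
    (h' : IsLogForms p q a b c e F' G') : definingPoly p q a b c e ∣ F * G' - F' * G := by
  have hr : ∀ r : K, F * G' - F' * G = (F - C r * G) * G' - (F' - C r * G') * G := fun r => by ring
  refine definingPoly_dvd hp hq hpq ?_ ?_ ?_ ?_
  · exact dvd_sub (h.dvd_zero.mul_right _) (h'.dvd_zero.mul_right _)
  · exact dvd_sub (h'.dvd_one.mul_left _) (h.dvd_one.mul_left _)
  · rw [hr p]; exact dvd_sub (h.dvd_fst.mul_right _) (h'.dvd_fst.mul_right _)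
  · rw [hr q]; exact dvd_sub (h.dvd_snd.mul_right _) (h'.dvd_snd.mul_right _)

end Homogenize

open MvPolynomial

theorem IsHomogeneous.exists_eq_mul_C {K : Type*} [Field K] {σ : Type*} {P Q : MvPolynomial σ K}
    {n : ℕ} (hP : P.IsHomogeneous n) (hQ : Q.IsHomogeneous n) (hP0 : P ≠ 0) (h : Q ∣ P) :
    ∃ k : K, k ≠ 0 ∧ P = Q * C k := by
  obtain ⟨w, rfl⟩ := h
  have hQ0 := left_ne_zero_of_mul hP0
  have hw0 := right_ne_zero_of_mul hP0
  have h1 := totalDegree_mul_of_isDomain hQ0 hw0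
  rw [hP.totalDegree hP0, hQ.totalDegree hQ0] at h1
  obtain ⟨k, rfl⟩ : ∃ k, w = C k := ⟨_, totalDegree_eq_zero_iff_eq_C.1 (by omega)⟩
  exact ⟨k, by simpa using hw0, rfl⟩

theorem exists_basis_pair {R M : Type*} [CommRing R] [AddCommGroup M] [Module R M] (x y : M)
    (hli : ∀ s t : R, s • x + t • y = 0 → s = 0 ∧ t = 0)
    (hspan : ∀ z : M, ∃ s t : R, s • x + t • y = z) :
    ∃ B : Module.Basis (Fin 2) R M, B 0 = x ∧ B 1 = y := by
  have hspan' : ⊤ ≤ Submodule.span R (Set.range ![x, y]) := by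
    rintro z -
    rw [Matrix.range_cons, Matrix.range_cons, Matrix.range_empty, Set.union_empty,
      Set.singleton_union, Submodule.mem_span_pair]
    exact hspan z
  refine ⟨Module.Basis.mk (LinearIndependent.pair_iff.2 hli) hspan', ?_⟩
  rw [Module.Basis.mk_apply, Module.Basis.mk_apply]
  exact ⟨rfl, rfl⟩

/-! ### Logarithmic derivations of the four lines and Saito's criterion. -/

namespace Multiarrangement

variable {K : Type*} [Field K]

theorem exists_eq_smul_of_ker_eq {V : Type*} [AddCommGroup V] [Module K V]
    {α β : Module.Dual K V} (h : LinearMap.ker α = LinearMap.ker β) :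
    ∃ r : K, r ≠ 0 ∧ β = r • α := by
  have h1 : β ∈ Submodule.span K (Set.range fun _ : Unit => α) :=
    mem_span_of_iInf_ker_le_ker (by simp [h])
  rw [Set.range_const, Submodule.mem_span_singleton] at h1
  obtain ⟨r, rfl⟩ := h1
  by_cases hr : r = 0
  · refine ⟨1, one_ne_zero, ?_⟩
    rw [hr, zero_smul, LinearMap.ker_zero, LinearMap.ker_eq_top] at h
    rw [h, smul_zero, smul_zero]
  · exact ⟨r, hr, rfl⟩

theorem formPoly_smul {ℓ : ℕ} (r : K) (α : Module.Dual K (Fin ℓ → K)) :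
    formPoly (r • α) = C r * formPoly α := by
  simp [formPoly, Finset.mul_sum, mul_assoc]

theorem pow_formPoly_smul_dvd {ℓ : ℕ} {r : K} (hr : r ≠ 0) (α : Module.Dual K (Fin ℓ → K)) (n : ℕ)
    (θ : Derivation K (MvPolynomial (Fin ℓ) K) (MvPolynomial (Fin ℓ) K))
    (h : formPoly α ^ n ∣ θ (formPoly α)) : formPoly (r • α) ^ n ∣ θ (formPoly (r • α)) := by
  have hu : IsUnit (C r : MvPolynomial (Fin ℓ) K) := (IsUnit.mk0 r hr).map C
  rw [formPoly_smul, mul_pow, (hu.pow n).mul_left_dvd, ← MvPolynomial.smul_eq_C_mul,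
    Derivation.map_smul, MvPolynomial.smul_eq_C_mul]
  exact h.mul_left _

theorem IsDefinedBy.mem_logDer_iff {ℓ : ℕ} {A : Multiarrangement K ℓ} {ι : Type*}
    {α : ι → Module.Dual K (Fin ℓ → K)} {k : ι → ℕ} (hA : A.IsDefinedBy α k)
    (θ : Derivation K (MvPolynomial (Fin ℓ) K) (MvPolynomial (Fin ℓ) K)) :
    θ ∈ A.logDer ↔ ∀ i, formPoly (α i) ^ k i ∣ θ (formPoly (α i)) := by
  obtain ⟨e, he⟩ := hA
  constructor
  · intro h i
    have := h (e i) (α i) (he i).1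
    rwa [(he i).2] at this
  · intro h H β hβ
    obtain ⟨i, rfl⟩ := e.surjective H
    obtain ⟨r, hr, rfl⟩ := exists_eq_smul_of_ker_eq ((he i).1.trans hβ.symm)
    rw [(he i).2]
    exact pow_formPoly_smul_dvd hr _ _ _ (h i)

theorem IsDefinedBy.size_eq {ℓ : ℕ} {A : Multiarrangement K ℓ} {ι : Type*} [Fintype ι]
    {α : ι → Module.Dual K (Fin ℓ → K)} {k : ι → ℕ} (hA : A.IsDefinedBy α k) :
    A.size = ∑ i, k i := by
  obtain ⟨e, he⟩ := hA
  rw [size, ← e.sum_comp]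
  exact Finset.sum_congr rfl fun i _ => (he i).2

theorem IsDefinedBy.card_eq {ℓ : ℕ} {A : Multiarrangement K ℓ} {ι : Type*} [Fintype ι]
    {α : ι → Module.Dual K (Fin ℓ → K)} {k : ι → ℕ} (hA : A.IsDefinedBy α k) :
    A.hyperplanes.card = Fintype.card ι := by
  obtain ⟨e, -⟩ := hA
  rw [← Fintype.card_coe, Fintype.card_congr e]

/-- The forms defining the lines `x = 0`, `y = 0`, `x = p y` and `x = q y`. -/
abbrev fourForms (p q : K) : Fin 4 → Module.Dual K (Fin 2 → K) :=
  ![LinearMap.proj 0, LinearMap.proj 1,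
    LinearMap.proj 0 - p • LinearMap.proj 1, LinearMap.proj 0 - q • LinearMap.proj 1]

variable {p q : K} {a b c e : ℕ} {A : Multiarrangement K 2}

theorem formPoly_proj_sub (r : K) :
    formPoly (LinearMap.proj 0 - r • LinearMap.proj 1 : Module.Dual K (Fin 2 → K))
      = X 0 - C r * X 1 := by
  simp [formPoly, Fin.sum_univ_two, sub_eq_add_neg]

theorem mem_logDer_iff_isLogForms (hA : A.IsDefinedBy (fourForms p q) ![a, b, c, e])
    (θ : Derivation K (MvPolynomial (Fin 2) K) (MvPolynomial (Fin 2) K)) :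
    θ ∈ A.logDer ↔ IsLogForms p q a b c e (θ (X 0)) (θ (X 1)) := by
  have h0 : formPoly (LinearMap.proj 0 : Module.Dual K (Fin 2 → K)) = X 0 := by
    simp [formPoly, Fin.sum_univ_two]
  have h1 : formPoly (LinearMap.proj 1 : Module.Dual K (Fin 2 → K)) = X 1 := by
    simp [formPoly, Fin.sum_univ_two]
  have hθ : ∀ r : K, θ (X 0 - C r * X 1) = θ (X 0) - C r * θ (X 1) := fun r => by
    rw [map_sub, ← MvPolynomial.smul_eq_C_mul, Derivation.map_smul, MvPolynomial.smul_eq_C_mul]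
  rw [hA.mem_logDer_iff]
  constructor
  · intro h
    have t0 := h 0
    have t1 := h 1
    have t2 := h 2
    have t3 := h 3
    simp only [fourForms, Matrix.cons_val, h0, h1, formPoly_proj_sub, hθ] at t0 t1 t2 t3
    exact ⟨t0, t1, t2, t3⟩
  · intro h i
    fin_cases i
    · simpa only [fourForms, Fin.zero_eta, Matrix.cons_val, h0] using h.dvd_zero
    · simpa only [fourForms, Fin.mk_one, Matrix.cons_val, h1] using h.dvd_one
    · simpa only [fourForms, Fin.reduceFinMk, Matrix.cons_val, formPoly_proj_sub, hθ]
        using h.dvd_fst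
    · simpa only [fourForms, Fin.reduceFinMk, Matrix.cons_val, formPoly_proj_sub, hθ]
        using h.dvd_snd

theorem derivation_ext_iff {θ η : Derivation K (MvPolynomial (Fin 2) K) (MvPolynomial (Fin 2) K)} :
    θ = η ↔ θ (X 0) = η (X 0) ∧ θ (X 1) = η (X 1) := by
  refine ⟨fun h => h ▸ ⟨rfl, rfl⟩, fun h => MvPolynomial.derivation_ext fun i => ?_⟩
  fin_cases i
  · exact h.1
  · exact h.2

/-- Saito's criterion: two logarithmic derivations whose determinant is a non-zero scalar multiple
of the defining polynomial form a basis. -/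
theorem exists_basis_of_det (hp : p ≠ 0) (hq : q ≠ 0) (hpq : p ≠ q)
    (hA : A.IsDefinedBy (fourForms p q) ![a, b, c, e]) {F₁ G₁ F₂ G₂ : MvPolynomial (Fin 2) K}
    (h₁ : IsLogForms p q a b c e F₁ G₁) (h₂ : IsLogForms p q a b c e F₂ G₂) {k : K} (hk : k ≠ 0)
    (hQ : definingPoly p q a b c e ≠ 0)
    (hdet : F₁ * G₂ - F₂ * G₁ = definingPoly p q a b c e * C k) :
    ∃ B : Module.Basis (Fin 2) (MvPolynomial (Fin 2) K) A.logDer,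
      (B 0).1 (X 0) = F₁ ∧ (B 0).1 (X 1) = G₁ ∧ (B 1).1 (X 0) = F₂ ∧ (B 1).1 (X 1) = G₂ := by
  have hval : ∀ F G : MvPolynomial (Fin 2) K, mkDerivation K ![F, G] (X 0) = F ∧
      mkDerivation K ![F, G] (X 1) = G := fun F G => by
    constructor <;> rw [mkDerivation_X] <;> rfl
  let θ₁ : A.logDer := ⟨mkDerivation K ![F₁, G₁], (mem_logDer_iff_isLogForms hA _).2
    (by rw [(hval F₁ G₁).1, (hval F₁ G₁).2]; exact h₁)⟩
  let θ₂ : A.logDer := ⟨mkDerivation K ![F₂, G₂], (mem_logDer_iff_isLogForms hA _).2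
    (by rw [(hval F₂ G₂).1, (hval F₂ G₂).2]; exact h₂)⟩
  have hCk : C k⁻¹ * C k = (1 : MvPolynomial (Fin 2) K) := by
    rw [← C_mul, inv_mul_cancel₀ hk, C_1]
  have hdet0 : F₁ * G₂ - F₂ * G₁ ≠ 0 := by
    rw [hdet]; exact mul_ne_zero hQ (by simpa using hk)
  have happly : ∀ s t : MvPolynomial (Fin 2) K,
      (s • θ₁ + t • θ₂).1 (X 0) = s * F₁ + t * F₂ ∧
      (s • θ₁ + t • θ₂).1 (X 1) = s * G₁ + t * G₂ := by
    intro s t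
    have hX : ∀ i, (s • θ₁ + t • θ₂).1 (X i) = s * θ₁.1 (X i) + t * θ₂.1 (X i) := fun i => rfl
    rw [hX, hX, (hval F₁ G₁).1, (hval F₁ G₁).2, (hval F₂ G₂).1, (hval F₂ G₂).2]
    exact ⟨rfl, rfl⟩
  have hli : ∀ s t : MvPolynomial (Fin 2) K, s • θ₁ + t • θ₂ = 0 → s = 0 ∧ t = 0 := by
    intro s t hst
    have h := happly s t
    rw [hst] at h
    have e0 : 0 = s * F₁ + t * F₂ := h.1
    have e1 : 0 = s * G₁ + t * G₂ := h.2
    constructor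
    · refine (mul_eq_zero.1 (?_ : s * (F₁ * G₂ - F₂ * G₁) = 0)).resolve_right hdet0
      linear_combination -G₂ * e0 + F₂ * e1
    · refine (mul_eq_zero.1 (?_ : t * (F₁ * G₂ - F₂ * G₁) = 0)).resolve_right hdet0
      linear_combination G₁ * e0 - F₁ * e1
  have hspan : ∀ θ : A.logDer, ∃ s t : MvPolynomial (Fin 2) K, s • θ₁ + t • θ₂ = θ := by
    intro θ
    have hθ := (mem_logDer_iff_isLogForms hA θ.1).1 θ.2
    -- Cramer's rule: the coordinates of θ are the determinants with one column replaced, divided by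
    -- the determinant of the pair.
    obtain ⟨x, hx⟩ := hθ.definingPoly_dvd_det hp hq hpq h₂
    obtain ⟨y, hy⟩ := h₁.definingPoly_dvd_det hp hq hpq hθ
    refine ⟨C k⁻¹ * x, C k⁻¹ * y, Subtype.ext (derivation_ext_iff.2 ?_)⟩
    rw [(happly _ _).1, (happly _ _).2]
    constructor <;> refine mul_left_cancel₀ hQ ?_
    · linear_combination (-C k⁻¹ * F₁) * hx - (C k⁻¹ * F₂) * hy + (C k⁻¹ * θ.1 (X 0)) * hdet
        + (definingPoly p q a b c e * θ.1 (X 0)) * hCk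
    · linear_combination (-C k⁻¹ * G₁) * hx - (C k⁻¹ * G₂) * hy + (C k⁻¹ * θ.1 (X 1)) * hdet
        + (definingPoly p q a b c e * θ.1 (X 1)) * hCk
  obtain ⟨B, hB0, hB1⟩ := exists_basis_pair θ₁ θ₂ hli hspan
  refine ⟨B, ?_⟩
  rw [hB0, hB1]
  exact ⟨(hval F₁ G₁).1, (hval F₁ G₁).2, (hval F₂ G₂).1, (hval F₂ G₂).2⟩

/-- The cofactor is the determinant of the coordinate matrix. This bounds the degree sum of an
arbitrary homogeneous basis from above. -/
theorem det_dvd_det (B : Module.Basis (Fin 2) (MvPolynomial (Fin 2) K) A.logDer)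
    (θ η : A.logDer) :
    (B 0).1 (X 0) * (B 1).1 (X 1) - (B 1).1 (X 0) * (B 0).1 (X 1) ∣
      θ.1 (X 0) * η.1 (X 1) - η.1 (X 0) * θ.1 (X 1) := by
  have hrepr : ∀ (ζ : A.logDer) i,
      ζ.1 (X i) = B.repr ζ 0 * (B 0).1 (X i) + B.repr ζ 1 * (B 1).1 (X i) := fun ζ i => by
    have h1 := B.sum_repr ζ
    rw [Fin.sum_univ_two] at h1
    conv_lhs => rw [← h1]
    rfl
  refine ⟨B.repr θ 0 * B.repr η 1 - B.repr θ 1 * B.repr η 0, ?_⟩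
  rw [hrepr θ 0, hrepr θ 1, hrepr η 0, hrepr η 1]
  ring

end Multiarrangement

/-! ### The theorem. -/

open Multiarrangement in
theorem corollary3p9 {K : Type*} [Field K] [CharZero K] (z₃ z₄ : K)
    (hz₃ : IsAlgebraic ℚ z₃) (hz₄ : Transcendental ℚ z₄) (m₁ m₂ m₃ m₄ : ℕ)
    (A : Multiarrangement K 2)
    (hA : A.IsDefinedBy
      ![LinearMap.proj 0, LinearMap.proj 1,
        LinearMap.proj 0 - z₃ • LinearMap.proj 1, LinearMap.proj 0 - z₄ • LinearMap.proj 1]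
      ![m₁, m₂, m₃, m₄])
    (hbal : A.IsBalanced) (hm : ¬ A.IsSimple) :
    (∃ δ : ℤ, A.HasDifference δ) ∧
      ∀ δ : ℤ, A.HasDifference δ → δ ≤ 1 ∧ δ ≠ (A.hyperplanes.card : ℤ) - 2 := by
  have hA' : A.IsDefinedBy (fourForms z₃ z₄) ![m₁, m₂, m₃, m₄] := hA
  have hcard : A.hyperplanes.card = 4 := hA'.card_eq
  have hsize : A.size = m₁ + m₂ + m₃ + m₄ := by
    rw [hA'.size_eq, Fin.sum_univ_four]; rfl
  obtain ⟨ε, hε⟩ := hA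
  have hpos : ∀ i, 0 < ![m₁, m₂, m₃, m₄] i := fun i => (hε i).2 ▸ A.mult_pos (ε i)
  have hlt : ∀ i, 2 * ![m₁, m₂, m₃, m₄] i < m₁ + m₂ + m₃ + m₄ := fun i => by
    rw [← (hε i).2, ← hsize]; exact hbal (ε i)
  have hone : ¬ (m₁ = 1 ∧ m₂ = 1 ∧ m₃ = 1 ∧ m₄ = 1) := by
    rintro ⟨rfl, rfl, rfl, rfl⟩
    refine hm fun H => ?_
    obtain ⟨i, rfl⟩ := ε.surjective H
    rw [(hε i).2]
    fin_cases i <;> rfl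
  have p1 : 0 < m₁ := hpos 0
  have p2 : 0 < m₂ := hpos 1
  have p3 : 0 < m₃ := hpos 2
  have p4 : 0 < m₄ := hpos 3
  have b1 : 2 * m₁ < m₁ + m₂ + m₃ + m₄ := hlt 0
  have b2 : 2 * m₂ < m₁ + m₂ + m₃ + m₄ := hlt 1
  have b3 : 2 * m₃ < m₁ + m₂ + m₃ + m₄ := hlt 2
  have b4 : 2 * m₄ < m₁ + m₂ + m₃ + m₄ := hlt 3
  have hz₃0 : z₃ ≠ 0 := by
    rintro rfl
    have h02 : ε 0 = ε 2 := Subtype.ext ((hε 0).1.symm.trans (Eq.trans (by simp) (hε 2).1))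
    exact absurd (ε.injective h02) (by decide)
  have hz₄0 : z₄ ≠ 0 := by
    rintro rfl
    exact hz₄ isAlgebraic_zero
  have hz : z₃ ≠ z₄ := by
    rintro rfl
    exact hz₄ hz₃
  have ht : Transcendental ℚ (z₄ / z₃) := fun h => hz₄ (by
    have := h.mul hz₃
    rwa [div_mul_cancel₀ _ hz₃0] at this)
  have hmin : ∀ j f g, 2 * j + 2 ≤ m₁ + m₂ + m₃ + m₄ → IsLogPair z₃ z₄ m₁ m₂ m₃ m₄ j f g →
      f = 0 ∧ g = 0 := fun j f g hj h =>
    h.eq_zero_of_transcendental hz₃0 ht p1 p2 p3 p4 b1 b2 b3 b4 hone hj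
  obtain ⟨k, k', hk0, hkk, hsum, hk1⟩ : ∃ k k', 0 < k ∧ k ≤ k' ∧ m₁ + m₂ + m₃ + m₄ = k + k' ∧
      k' ≤ k + 1 :=
    ⟨(m₁ + m₂ + m₃ + m₄) / 2, m₁ + m₂ + m₃ + m₄ - (m₁ + m₂ + m₃ + m₄) / 2, by omega, by omega,
      by omega, by omega⟩
  obtain ⟨f₁, g₁, f₂, g₂, h₁, h₂, hdet⟩ := IsLogPair.exists_det_ne_zero hk0 hkk hsum hk1
    (by omega) (by omega) fun j hj f g => hmin j f g (by omega)
  have hf₁ := isHomogeneous_homogenize k f₁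
  have hg₁ := isHomogeneous_homogenize k g₁
  have hf₂ := isHomogeneous_homogenize k' f₂
  have hg₂ := isHomogeneous_homogenize k' g₂
  have hdet' : homogenize k f₁ * homogenize k' g₂ - homogenize k' f₂ * homogenize k g₁ ≠ 0 := by
    intro h0
    have := congrArg dehomogenize h0
    rw [map_sub, map_mul, map_mul, dehomogenize_homogenize h₁.natDegree_left_le,
      dehomogenize_homogenize h₁.natDegree_right_le, dehomogenize_homogenize h₂.natDegree_left_le,
      dehomogenize_homogenize h₂.natDegree_right_le, map_zero] at this
    exact hdet this
  have hdeg : (homogenize k f₁ * homogenize k' g₂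
      - homogenize k' f₂ * homogenize k g₁).IsHomogeneous (m₁ + m₂ + m₃ + m₄) := by
    rw [hsum]
    have := hf₂.mul hg₁
    rw [add_comm k' k] at this
    exact (hf₁.mul hg₂).sub this
  obtain ⟨κ, hκ, hκQ⟩ := IsHomogeneous.exists_eq_mul_C hdeg
    (isHomogeneous_definingPoly z₃ z₄ m₁ m₂ m₃ m₄) hdet'
    (h₁.isLogForms.definingPoly_dvd_det hz₃0 hz₄0 hz h₂.isLogForms)
  have hQ0 : definingPoly z₃ z₄ m₁ m₂ m₃ m₄ ≠ 0 := fun h0 => hdet' (by rw [hκQ, h0, zero_mul])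
  obtain ⟨B, hB1, hB2, hB3, hB4⟩ := exists_basis_of_det hz₃0 hz₄0 hz hA' h₁.isLogForms
    h₂.isLogForms hκ hQ0 hκQ
  refine ⟨⟨_, ![k, k'], ⟨B, fun i j => ?_⟩, rfl⟩, ?_⟩
  · fin_cases i <;> fin_cases j
    · exact hB1 ▸ hf₁
    · exact hB2 ▸ hg₁
    · exact hB3 ▸ hf₂
    · exact hB4 ▸ hg₂
  rintro _ ⟨d, ⟨B', hB'⟩, rfl⟩
  have hge : ∀ i, k ≤ d i := by
    intro i
    by_contra! hlt
    have hpair := ((mem_logDer_iff_isLogForms hA' _).1 (B' i).2).isLogPair (hB' i 0) (hB' i 1)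
    have h0 := hmin (d i) _ _ (by omega) hpair
    refine B'.ne_zero i (Subtype.ext (derivation_ext_iff.2 ⟨?_, ?_⟩))
    · exact eq_of_dehomogenize_eq (hB' i 0) (isHomogeneous_zero _ _ _) (h0.1.trans (map_zero _).symm)
    · exact eq_of_dehomogenize_eq (hB' i 1) (isHomogeneous_zero _ _ _) (h0.2.trans (map_zero _).symm)
  have hdvd := det_dvd_det B' (B 0) (B 1)
  rw [hB1, hB2, hB3, hB4] at hdvd
  -- The determinant of `B'` is homogeneous of degree `d 0 + d 1` and divides that of `B`, which is
  -- non-zero of degree |m|.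
  have hle : d 0 + d 1 ≤ m₁ + m₂ + m₃ + m₄ := by
    have h3 := (hB' 1 0).mul (hB' 0 1)
    rw [add_comm (d 1)] at h3
    have h4 := ((hB' 0 0).mul (hB' 1 1)).sub h3
    obtain ⟨w, hw⟩ := hdvd
    have h5 := hdet'
    rw [hw] at h5
    have h6 := totalDegree_mul_of_isDomain (left_ne_zero_of_mul h5) (right_ne_zero_of_mul h5)
    rw [← hw, hdeg.totalDegree hdet', h4.totalDegree (left_ne_zero_of_mul h5)] at h6
    omega
  have h0 := hge 0
  have h1 := hge 1
  have hδ : |(d 0 : ℤ) - (d 1 : ℤ)| ≤ 1 := abs_le.2 ⟨by omega, by omega⟩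
  refine ⟨hδ, ?_⟩
  rw [hcard]
  push_cast
  omega
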